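/- Let $n\ge 1$ and let $F^2(H_n)=\bigoplus_{k\ge 0}H_n^{\otimes k}$ be the full Fock space of an $n$-dimensional complex Hilbert space $H_n$ with orthonormal basis $e_1,\dots,e_n$. For words $\alpha=g_{i_1}\cdots g_{i_k}$ in the free semigroup $\mathbb F_n^+$ put $|\alpha|=k$, $e_\alpha=e_{i_1}\otimes\cdots\otimes e_{i_k}$, and let $S_ie_\alpha=e_i\otimes e_\alpha$ and $R_ie_\alpha=e_\alpha\otimes e_i$ be the left and right creation operators. Let $F_n^\infty$ be the WOT-closed algebra generated by $S_1,\dots,S_n$ and $I$, and let $J\ne F_n^\infty$ be a WOT-closed two-sided ideal of $F_n^\infty$. Put $\mathcal N_J=F^2(H_n)\ominus\overline{JF^2(H_n)}$, $B_i=P_{\mathcal N_J}S_i|_{\mathcal N_J}$ and $W_i=P_{\mathcal N_J}R_i|_{\mathcal N_J}$. Let $T=[T_1,\dots,T_n]$ be bounded operators on a complex Hilbert space $\mathcal H$, with $T_\alpha=T_{i_1}\cdots T_{i_k}$, such that * $\sum_iT_iT_i^*\le I$ (row contraction); * there is no $h\ne0$ with $\sum_{|\alpha|=k}\|T_\alpha^*h\|^2=\|h\|^2$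 for all $k\ge1$ (completely non-coisometric, c.n.c.); * for every $f=\sum_\alpha a_\alpha S_\alpha\in J$, $f(T_1,\dots,T_n):=\text{SOT-}\lim_{r\to1^-}\sum_{k\ge0}\sum_{|\alpha|=k}r^{|\alpha|}a_\alpha T_\alpha=0$ ($J$-constrained). Let $\Delta_T=(I-\sum_iT_iT_i^*)^{1/2}$ on $\mathcal H$, $\Delta_{T^*}=(I-T^*T)^{1/2}$ on $\mathcal H^{(n)}$, $\mathcal D_T=\overline{\Delta_T\mathcal H}$ and $\mathcal D_{T^*}=\overline{\Delta_{T^*}\mathcal H^{(n)}}$. The constrained characteristic function $\Theta_{J,T}:\mathcal N_J\otimes\mathcal D_{T^*}\to\mathcal N_J\otimes\mathcal D_T$ is the bounded operator with formal Fourier representation $$-I_{\mathcal N_J}\otimes T+(I_{\mathcal N_J}\otimes\Delta_T)\Big(I_{\mathcal N_J\otimes\mathcal H}-\sum_{i=1}^nW_i\otimes T_i^*\Big)^{-1}[W_1\otimes I_{\mathcal H},\dots,W_n\otimes I_{\mathcal H}](I_{\mathcal N_J}\otimes\Delta_{T^*}),$$ that is, the SOT-limit as $r\to1^-$ of the operators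 obtained by replacing each $W_i$ by $rW_i$. Then $\Theta_{J,T}$ is outer (that is, $\Theta_{J,T}(B_i\otimes I_{\mathcal D_{T^*}})=(B_i\otimes I_{\mathcal D_T})\Theta_{J,T}$ for all $i$, and $\Theta_{J,T}$ has dense range) if and only if there is no $h\in\mathcal H$, $h\neq0$, such that $$\lim_{k\to\infty}\sum_{|\alpha|=k}T_\alpha T_\alpha^*h=0.$$ -/

import Mathlib

set_option linter.unusedSectionVars false
open Filter Topology
open scoped InnerProductSpace InnerProduct

noncomputable section

namespace NCFock

/-- The unital free semigroup on `n` generators; `FreeMonoid.length` is the length of a word. -/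
abbrev Word (n : ℕ) : Type := FreeMonoid (Fin n)

instance (n : ℕ) : DecidableEq (Word n) := inferInstanceAs (DecidableEq (List (Fin n)))

/-- The Hilbert tensor product `F²(H_n) ⊗ K` of the full Fock space on `n` generators with a
Hilbert space `K`, in the orthonormal basis `(e_α)` of `F²(H_n)`: square summable families
`(x_α)` of vectors of `K`, with `x` standing for `∑ e_α ⊗ x_α`. -/
abbrev Fock (n : ℕ) (K : Type*) [NormedAddCommGroup K] : Type _ :=
  lp (fun _ : Word n => K) 2

/-- The full Fock space `F²(H_n)`, with `e_α` the family that is `1` at `α` and `0` elsewhere. -/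
abbrev FockSpace (n : ℕ) : Type := Fock n ℂ

section Operators

variable {n : ℕ} {K K' K'' : Type*}
  [NormedAddCommGroup K] [InnerProductSpace ℂ K]
  [NormedAddCommGroup K'] [InnerProductSpace ℂ K']
  [NormedAddCommGroup K''] [InnerProductSpace ℂ K'']

theorem memlp_iff (f : Word n → K) : Memℓp f 2 ↔ Summable fun a => ‖f a‖ ^ 2 := by
  rw [memℓp_gen_iff (by norm_num)]
  norm_num

theorem summable_sq (x : Fock n K) : Summable fun a => ‖x a‖ ^ 2 :=
  (memlp_iff _).1 x.2

theorem norm_sq_eq (x : Fock n K) : ‖x‖ ^ 2 = ∑' a, ‖x a‖ ^ 2 := by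
  have := lp.norm_rpow_eq_tsum (p := 2) (by norm_num) x
  norm_num at this
  exact this

theorem norm_sq_extend {σ : Word n → Word n} (hσ : Function.Injective σ) (x : Fock n K) :
    (fun a => ‖Function.extend σ (x : Word n → K) 0 a‖ ^ 2) =
      Function.extend σ (fun a => ‖x a‖ ^ 2) 0 := by
  funext a
  by_cases h : ∃ b, σ b = a
  · obtain ⟨b, rfl⟩ := h
    simp [hσ.extend_apply]
  · simp [Function.extend_apply' _ _ _ h]

/-- The isometry `e_α ⊗ k ↦ e_{σ α} ⊗ k` given by an injective map `σ` of words. -/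
def shiftAlong (K : Type*) [NormedAddCommGroup K] [InnerProductSpace ℂ K]
    (σ : Word n → Word n) (hσ : Function.Injective σ) : Fock n K →ₗᵢ[ℂ] Fock n K where
  toFun x := ⟨Function.extend σ (x : Word n → K) 0, by
    refine (memlp_iff _).2 ?_
    rw [norm_sq_extend hσ]
    exact (Function.Injective.summable_iff hσ (fun a ha => by
      rw [Function.extend_apply' _ _ _ (by simpa using ha)]; rfl)).1
      (by simpa [Function.comp_def, hσ.extend_apply] using summable_sq x)⟩
  map_add' x y := by
    ext a
    by_cases h : ∃ b, σ b = a
    · obtain ⟨b, rfl⟩ := h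
      change Function.extend σ (⇑(x + y) : Word n → K) 0 (σ b) =
        Function.extend σ (x : Word n → K) 0 (σ b) + Function.extend σ (y : Word n → K) 0 (σ b)
      rw [hσ.extend_apply, hσ.extend_apply, hσ.extend_apply]
      rfl
    · change Function.extend σ (⇑(x + y) : Word n → K) 0 a =
        Function.extend σ (x : Word n → K) 0 a + Function.extend σ (y : Word n → K) 0 a
      rw [Function.extend_apply' _ _ _ h, Function.extend_apply' _ _ _ h,
        Function.extend_apply' _ _ _ h]
      simp
  map_smul' c x := by
    ext a
    by_cases h : ∃ b, σ b = a
    · obtain ⟨b, rfl⟩ := h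
      simp [hσ.extend_apply]
    · simp [Function.extend_apply' _ _ _ h]
  norm_map' x := by
    refine (sq_eq_sq₀ (norm_nonneg _) (norm_nonneg _)).1 ?_
    rw [norm_sq_eq, norm_sq_eq]
    change ∑' a, ‖Function.extend σ (x : Word n → K) 0 a‖ ^ 2 = _
    rw [norm_sq_extend hσ]
    exact tsum_extend_zero hσ _

theorem shiftAlong_apply {σ : Word n → Word n} (hσ : Function.Injective σ) (x : Fock n K)
    (a : Word n) : shiftAlong K σ hσ x (σ a) = x a :=
  hσ.extend_apply _ _ _

theorem shiftAlong_apply' {σ : Word n → Word n} (hσ : Function.Injective σ) (x : Fock n K)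
    (a : Word n) (h : ¬ ∃ b, σ b = a) : shiftAlong K σ hσ x a = 0 :=
  Function.extend_apply' _ _ _ h

/-- The left creation operator `S_i ⊗ I_K`, with `S_i e_α = e_i ⊗ e_α`. -/
def leftCreation (K : Type*) [NormedAddCommGroup K] [InnerProductSpace ℂ K] (i : Fin n) :
    Fock n K →L[ℂ] Fock n K :=
  (shiftAlong K (fun a => FreeMonoid.of i * a) (mul_right_injective _)).toContinuousLinearMap

/-- The right creation operator `R_i ⊗ I_K`, with `R_i e_α = e_α ⊗ e_i`. -/
def rightCreation (K : Type*) [NormedAddCommGroup K] [InnerProductSpace ℂ K] (i : Fin n) :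
    Fock n K →L[ℂ] Fock n K :=
  (shiftAlong K (fun a => a * FreeMonoid.of i) (mul_left_injective _)).toContinuousLinearMap

/-- The operator `I ⊗ X` on `F²(H_n) ⊗ K`. -/
def ampl (X : K →L[ℂ] K') : Fock n K →L[ℂ] Fock n K' :=
  LinearMap.mkContinuous
    { toFun := fun x => ⟨fun a => X (x a), (memlp_iff _).2 <|
        Summable.of_nonneg_of_le (fun a => by positivity)
          (fun a => by
            rw [← mul_pow]
            exact pow_le_pow_left₀ (norm_nonneg _) (X.le_opNorm (x a)) 2)
          ((summable_sq x).mul_left (‖X‖ ^ 2))⟩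
      map_add' := fun x y => by ext a; exact map_add X (x a) (y a)
      map_smul' := fun c x => by ext a; exact map_smul X c (x a) } ‖X‖ (fun x => by
    refine (sq_le_sq₀ (norm_nonneg _) (by positivity)).1 ?_
    rw [mul_pow, norm_sq_eq, norm_sq_eq, ← tsum_mul_left]
    refine Summable.tsum_le_tsum (fun a => ?_) (summable_sq _)
      ((summable_sq x).mul_left (‖X‖ ^ 2))
    rw [← mul_pow]
    exact pow_le_pow_left₀ (norm_nonneg _) (X.le_opNorm (x a)) 2)

@[simp] theorem ampl_apply (X : K →L[ℂ] K') (x : Fock n K) (a : Word n) :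
    ampl X x a = X (x a) := rfl

/-- The elementary tensor `f ⊗ k`. -/
def tmul (f : FockSpace n) (k : K) : Fock n K :=
  ⟨fun a => f a • k, (memlp_iff _).2 <| by
    simpa [norm_smul, mul_pow] using (summable_sq f).mul_right (‖k‖ ^ 2)⟩

@[simp] theorem tmul_apply (f : FockSpace n) (k : K) (a : Word n) :
    tmul f k a = f a • k := rfl

end Operators

/-! ### The noncommutative analytic Toeplitz algebra and its ideals -/

/-- The noncommutative analytic Toeplitz algebra `F_n^∞`: the closure in the weak operator topology
of the algebra generated by the left creation operators and the identity. -/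
def toeplitzAlgebra (n : ℕ) : Subalgebra ℂ (FockSpace n →WOT[ℂ] FockSpace n) :=
  (Algebra.adjoin ℂ
    (Set.range fun i : Fin n => ContinuousLinearMapWOT.ofCLM (leftCreation ℂ i))).topologicalClosure

instance (n : ℕ) : NonUnitalNonAssocRing (toeplitzAlgebra n) := inferInstance

section Ideal

variable {n : ℕ} (J : TwoSidedIdeal (toeplitzAlgebra n))

/-- The ideal `J` is closed in the weak operator topology of `B(F²(H_n))`. -/
def IsWOTClosed : Prop :=
  IsClosed {A : FockSpace n →WOT[ℂ] FockSpace n | ∃ f ∈ J, f.1 = A}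

/-- The subspace `M_J`, the closure of `J F²(H_n)`. -/
def idealSpace : Submodule ℂ (FockSpace n) :=
  (Submodule.span ℂ {y | ∃ f ∈ J, ∃ x : FockSpace n, y = f.1 x}).topologicalClosure

/-- The subspace `N_J = F²(H_n) ⊖ M_J`. -/
def modelSpace : Submodule ℂ (FockSpace n) := (idealSpace J)ᗮ

/-- The subspace `N_J ⊗ K` of `F²(H_n) ⊗ K`: the closed span of the elementary tensors. -/
def tensorSpace (K : Type*) [NormedAddCommGroup K] [InnerProductSpace ℂ K] :
    Submodule ℂ (Fock n K) :=
  (Submodule.span ℂ {y | ∃ f ∈ modelSpace J, ∃ k : K, y = tmul f k}).topologicalClosure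

instance (K : Type*) [NormedAddCommGroup K] [InnerProductSpace ℂ K] [CompleteSpace K] :
    CompleteSpace (tensorSpace J K) :=
  inferInstanceAs (CompleteSpace (Submodule.topologicalClosure _))

variable {K K' : Type*}
  [NormedAddCommGroup K] [InnerProductSpace ℂ K] [CompleteSpace K]
  [NormedAddCommGroup K'] [InnerProductSpace ℂ K'] [CompleteSpace K']

/-- The compression `P_{N_J ⊗ K'} M |_{N_J ⊗ K}`. -/
def compress (M : Fock n K →L[ℂ] Fock n K') : tensorSpace J K →L[ℂ] tensorSpace J K' :=
  (tensorSpace J K').orthogonalProjectionOnto ∘L M ∘L (tensorSpace J K).subtypeL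

/-- The operator `I_{N_J} ⊗ X`. -/
def constrainedAmpl (X : K →L[ℂ] K') : tensorSpace J K →L[ℂ] tensorSpace J K' :=
  compress J (ampl X)

/-- The operator `W_i ⊗ X`, where `W_i = P_{N_J} R_i |_{N_J}` is the constrained right creation
operator. -/
def constrainedRight (i : Fin n) (X : K →L[ℂ] K') : tensorSpace J K →L[ℂ] tensorSpace J K' :=
  compress J (rightCreation K' i ∘L ampl X)

/-- The operator `B_i ⊗ I_K`, where `B_i = P_{N_J} S_i |_{N_J}` is the constrained left creation
operator. -/
def constrainedLeft (K : Type*) [NormedAddCommGroup K] [InnerProductSpace ℂ K] [CompleteSpace K]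
    (i : Fin n) : tensorSpace J K →L[ℂ] tensorSpace J K :=
  compress J (leftCreation K i)

/-- Multi-analytic operators with respect to the constrained shifts `B_1, …, B_n`. -/
def IsMultiAnalytic (M : tensorSpace J K →L[ℂ] tensorSpace J K') : Prop :=
  ∀ i : Fin n, M ∘L constrainedLeft J K i = constrainedLeft J K' i ∘L M

/-- Outer operators: multi-analytic operators with dense range. -/
def IsOuter (M : tensorSpace J K →L[ℂ] tensorSpace J K') : Prop :=
  IsMultiAnalytic J M ∧ DenseRange M

end Ideal

/-! ### Row contractions -/

section Row

variable {n : ℕ} {H : Type*} [NormedAddCommGroup H] [InnerProductSpace ℂ H] [CompleteSpace H]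
  (T : Fin n → H →L[ℂ] H)

/-- `T_α = T_{i_1} ⋯ T_{i_k}` for the word `α = g_{i_1} ⋯ g_{i_k}`. -/
def wordOp (α : Word n) : H →L[ℂ] H := FreeMonoid.lift T α

/-- The word `g_{w 0} ⋯ g_{w (k - 1)}`; as `w` varies these are all the words of length `k`. -/
def wordOf {k : ℕ} (w : Fin k → Fin n) : Word n := FreeMonoid.ofList (List.ofFn w)

/-- `[T_1, …, T_n]` is a row contraction: `T_1 T_1^* + ⋯ + T_n T_n^* ≤ I`. -/
def IsRowContraction : Prop := ∑ i, T i ∘L (T i)† ≤ 1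

/-- `T` is completely non-coisometric: there is no nonzero `h` with
`∑_{|α| = k} ‖T_α^* h‖² = ‖h‖²` for all `k = 1, 2, …`. -/
def IsCNC : Prop :=
  ¬ ∃ h : H, h ≠ 0 ∧ ∀ k : ℕ, 1 ≤ k →
    ∑ w : Fin k → Fin n, ‖((wordOp T (wordOf w))†) h‖ ^ 2 = ‖h‖ ^ 2

/-- The Fourier coefficients `a_α` of `f = ∑ a_α S_α`, read off from `f 1 = ∑ a_α e_α`. -/
def fourierCoeff (f : toeplitzAlgebra n) (α : Word n) : ℂ := f.1 (lp.single 2 (1 : Word n) (1 : ℂ)) α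

/-- `f(rT_1, …, rT_n) = ∑_k ∑_{|α| = k} r^|α| a_α T_α`. -/
def radialCalculus (f : toeplitzAlgebra n) (r : ℝ) : H →L[ℂ] H :=
  ∑' k : ℕ, ∑ w : Fin k → Fin n, ((r : ℂ) ^ k * fourierCoeff f (wordOf w)) • wordOp T (wordOf w)

/-- `f(T_1, …, T_n) = X` in the functional calculus: `X` is the limit of `f(rT_1, …, rT_n)` as
`r → 1` in the strong operator topology. -/
def HasFunctionalCalculus (f : toeplitzAlgebra n) (X : H →L[ℂ] H) : Prop :=
  ∀ h : H, Tendsto (fun r : ℝ => radialCalculus T f r h) (𝓝[<] 1) (𝓝 (X h))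

/-- `T` is `J`-constrained: `f(T_1, …, T_n) = 0` for all `f ∈ J`. -/
def IsConstrained (J : TwoSidedIdeal (toeplitzAlgebra n)) : Prop :=
  ∀ f ∈ J, HasFunctionalCalculus T f 0

/-- The Hilbert space `H^(n)`, the direct sum of `n` copies of `H`. -/
abbrev HPow (n : ℕ) (H : Type*) : Type _ := PiLp 2 (fun _ : Fin n => H)

/-- The coordinate projection `H^(n) → H`. -/
abbrev coordProj (H : Type*) [NormedAddCommGroup H] [InnerProductSpace ℂ H] (i : Fin n) :
    HPow n H →L[ℂ] H := PiLp.proj 2 (fun _ : Fin n => H) i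

/-- The row operator `T : H^(n) → H`, `(x_1, …, x_n) ↦ T_1 x_1 + ⋯ + T_n x_n`. -/
def rowOp : HPow n H →L[ℂ] H := ∑ i, T i ∘L coordProj H i

/-- `Δ_T = (I - ∑ T_i T_i^*)^{1/2}`. -/
def defectOp : H →L[ℂ] H := CFC.sqrt (1 - ∑ i, T i ∘L (T i)†)

/-- `Δ_{T^*} = (I - T^* T)^{1/2}`. -/
def defectOpStar : HPow n H →L[ℂ] HPow n H := CFC.sqrt (1 - (rowOp T)† ∘L rowOp T)

/-- `D_T`, the closure of the range of `Δ_T`. -/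
def defectSpace : Submodule ℂ H := (defectOp T).range.topologicalClosure

/-- `D_{T^*}`, the closure of the range of `Δ_{T^*}`. -/
def defectSpaceStar : Submodule ℂ (HPow n H) :=
  (defectOpStar T).range.topologicalClosure

instance : CompleteSpace (defectSpace T) :=
  inferInstanceAs (CompleteSpace (Submodule.topologicalClosure _))

instance : CompleteSpace (defectSpaceStar T) :=
  inferInstanceAs (CompleteSpace (Submodule.topologicalClosure _))

/-- `Δ_T` as an operator from `H` to `D_T`. -/
def defectCod : H →L[ℂ] defectSpace T :=
  (defectOp T).codRestrict (defectSpace T)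
    (fun x => Submodule.le_topologicalClosure _ ⟨x, rfl⟩)

/-- `Δ_{T^*}` as an operator from `D_{T^*}` to `H^(n)`. -/
def defectStarDom : defectSpaceStar T →L[ℂ] HPow n H :=
  defectOpStar T ∘L (defectSpaceStar T).subtypeL

variable {T}

theorem sqrt_facts {E : Type*} [NormedAddCommGroup E] [InnerProductSpace ℂ E] [CompleteSpace E]
    {X : E →L[ℂ] E} (hX : X.IsPositive) :
    CFC.sqrt X * CFC.sqrt X = X ∧ (CFC.sqrt X).IsPositive :=
  ⟨CFC.sqrt_mul_sqrt_self _ ((ContinuousLinearMap.nonneg_iff_isPositive _).2 hX),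
    (ContinuousLinearMap.nonneg_iff_isPositive _).1 (CFC.sqrt_nonneg X)⟩

theorem rowOp_apply (x : HPow n H) : rowOp T x = ∑ i, T i (x i) := by
  simp [rowOp]

theorem proj_rowOp_adjoint (i : Fin n) (h : H) : ((rowOp T)†) h i = ((T i)†) h := by
  refine ext_inner_left ℂ fun k => ?_
  have := ContinuousLinearMap.adjoint_inner_right (rowOp T) (PiLp.single 2 i k) h
  rw [PiLp.inner_apply, Finset.sum_eq_single i, rowOp_apply, Finset.sum_eq_single i] at this
  · simpa [ContinuousLinearMap.adjoint_inner_right] using this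
  all_goals simp +contextual

theorem rowOp_comp_adjoint : rowOp T ∘L ((rowOp T)†) = ∑ i, T i ∘L ((T i)†) := by
  ext h
  simp [rowOp_apply, proj_rowOp_adjoint]

theorem isPositive_defect (hT : IsRowContraction T) :
    (1 - ∑ i, T i ∘L ((T i)†)).IsPositive :=
  (ContinuousLinearMap.nonneg_iff_isPositive _).1 (sub_nonneg.2 hT)

theorem norm_rowOp_adjoint_le (hT : IsRowContraction T) (h : H) :
    ‖((rowOp T)†) h‖ ≤ ‖h‖ := by
  have h1 := (isPositive_defect hT).re_inner_nonneg_left h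
  rw [← rowOp_comp_adjoint] at h1
  have h2 : ⟪(rowOp T) (((rowOp T)†) h), h⟫_ℂ = ⟪((rowOp T)†) h, ((rowOp T)†) h⟫_ℂ :=
    (ContinuousLinearMap.adjoint_inner_right _ _ _).symm
  simp only [sub_apply, one_apply_eq_self, ContinuousLinearMap.comp_apply,
    inner_sub_left, h2, map_sub, inner_self_eq_norm_sq] at h1
  exact (sq_le_sq₀ (norm_nonneg _) (norm_nonneg _)).1 (by linarith)

theorem norm_rowOp_le (hT : IsRowContraction T) (x : HPow n H) : ‖rowOp T x‖ ≤ ‖x‖ := by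
  have : ‖rowOp T‖ ≤ 1 := by
    rw [← LinearIsometryEquiv.norm_map ContinuousLinearMap.adjoint (rowOp T)]
    exact ContinuousLinearMap.opNorm_le_bound _ zero_le_one
      (fun h => by simpa using norm_rowOp_adjoint_le hT h)
  simpa using (rowOp T).le_of_opNorm_le this x

theorem isPositive_defectStar (hT : IsRowContraction T) :
    (1 - ((rowOp T)†) ∘L rowOp T).IsPositive := by
  rw [ContinuousLinearMap.isPositive_iff_complex]
  intro x
  have h2 : ⟪((rowOp T)†) (rowOp T x), x⟫_ℂ = ⟪rowOp T x, rowOp T x⟫_ℂ :=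
    ContinuousLinearMap.adjoint_inner_left _ _ _
  simp only [sub_apply, one_apply_eq_self, ContinuousLinearMap.comp_apply,
    inner_sub_left, h2, inner_self_eq_norm_sq_to_K]
  have := pow_le_pow_left₀ (norm_nonneg _) (norm_rowOp_le hT x) 2
  constructor
  · apply Complex.ext <;> simp [← Complex.ofReal_pow]
  · simp [← Complex.ofReal_pow, this]

theorem defectOp_sq (hT : IsRowContraction T) (h : H) :
    defectOp T (defectOp T h) = h - rowOp T (((rowOp T)†) h) := by
  have := congrArg (fun X : H →L[ℂ] H => X h) (sqrt_facts (isPositive_defect hT)).1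
  rw [← rowOp_comp_adjoint] at this
  rw [defectOp, ← rowOp_comp_adjoint]
  exact this

theorem defectOpStar_sq (hT : IsRowContraction T) (x : HPow n H) :
    defectOpStar T (defectOpStar T x) = x - ((rowOp T)†) (rowOp T x) :=
  congrArg (fun X : HPow n H →L[ℂ] HPow n H => X x) (sqrt_facts (isPositive_defectStar hT)).1

theorem defectOp_isPositive (hT : IsRowContraction T) : (defectOp T).IsPositive :=
  (sqrt_facts (isPositive_defect hT)).2

theorem defectOpStar_isPositive (hT : IsRowContraction T) : (defectOpStar T).IsPositive :=
  (sqrt_facts (isPositive_defectStar hT)).2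

/-- A Sylvester equation with positive coefficients that forces `R s = t R`. -/
theorem intertwine_aux {E F : Type*} [NormedAddCommGroup E] [InnerProductSpace ℂ E]
    [CompleteSpace E] [NormedAddCommGroup F] [InnerProductSpace ℂ F] [CompleteSpace F]
    {s : E →L[ℂ] E} {t : F →L[ℂ] F} (hs : s.IsPositive) (ht : t.IsPositive) (R : E →L[ℂ] F)
    (h : R ∘L s ∘L s = t ∘L t ∘L R) : R ∘L s = t ∘L R := by
  set Y : E →L[ℂ] F := R ∘L s - t ∘L R with hY
  have hsa : (s†) = s := hs.isSelfAdjoint.adjoint_eq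
  have hta : (t†) = t := ht.isSelfAdjoint.adjoint_eq
  have h1 : t ∘L Y = - (Y ∘L s) := by
    ext x
    have := congrArg (fun X : E →L[ℂ] F => X x) h
    simp only [ContinuousLinearMap.comp_apply] at this
    simp [hY, this]
  have hZ : ((Y†) ∘L Y ∘L s) = - ((Y†) ∘L t ∘L Y) := by
    rw [h1]; simp
  have hpos : ((Y†) ∘L t ∘L Y).IsPositive := ht.adjoint_conj Y
  have hYY : ((Y†) ∘L Y).IsPositive := ContinuousLinearMap.isPositive_adjoint_comp_self Y
  have hcomm : Commute ((Y†) ∘L Y) s := by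
    have e1 : ((Y†) ∘L Y ∘L s)† = (Y†) ∘L Y ∘L s := by
      rw [hZ, map_neg, hpos.isSelfAdjoint.adjoint_eq]
    have e2 : ((Y†) ∘L Y ∘L s)† = s ∘L (Y†) ∘L Y := by
      simp [ContinuousLinearMap.adjoint_comp, hsa, ContinuousLinearMap.comp_assoc]
    exact e1.symm.trans e2
  have hnn : (0 : E →L[ℂ] E) ≤ ((Y†) ∘L Y) * s :=
    Commute.mul_nonneg ((ContinuousLinearMap.nonneg_iff_isPositive _).2 hYY)
      ((ContinuousLinearMap.nonneg_iff_isPositive _).2 hs) hcomm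
  have hle : ((Y†) ∘L Y) * s ≤ 0 := by
    have : ((Y†) ∘L Y) * s = - ((Y†) ∘L t ∘L Y) := hZ
    rw [this, neg_nonpos]
    exact (ContinuousLinearMap.nonneg_iff_isPositive _).2 hpos
  have h0 : ((Y†) ∘L Y) * s = 0 := le_antisymm hle hnn
  have hYs : ∀ x, Y (s x) = 0 := by
    intro x
    have e : ((Y†)) (Y (s (s x))) = 0 := by
      have := congrArg (fun X : E →L[ℂ] E => X (s x)) h0
      simpa using this
    have e' : s (((Y†)) (Y (s x))) = 0 := by
      have := congrArg (fun X : E →L[ℂ] E => X (s x)) hcomm.eq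
      simp only [mul_apply_eq_comp, ContinuousLinearMap.comp_apply] at this
      rw [← this, e]
    have e'' : ((Y†)) (Y (s x)) = 0 := by
      have := congrArg (fun X : E →L[ℂ] E => X x) h0
      simpa using this
    have := ContinuousLinearMap.adjoint_inner_left Y (s x) (Y (s x))
    rw [e'', inner_zero_left] at this
    exact inner_self_eq_zero.1 this.symm
  have htY : ∀ x, t (Y x) = 0 := by
    intro x
    have := congrArg (fun X : E →L[ℂ] F => X x) h1
    simpa [hYs] using this
  have hY0 : Y = 0 := by
    ext x
    -- `Y* Y = s R* Y`, and `Y* Y` kills the range of `s`.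
    have a1 : ∀ z, ((Y†)) (Y z) = s ((R†) (Y z)) := by
      intro z
      have : (Y†) = s ∘L (R†) - (R†) ∘L t := by
        rw [hY, map_sub, ContinuousLinearMap.adjoint_comp, ContinuousLinearMap.adjoint_comp,
          hsa, hta]
      rw [this]
      simp [htY]
    have a2 : Y (((Y†)) (Y x)) = 0 := by rw [a1, hYs]
    have a3 : ((Y†)) (Y x) = 0 := by
      have := ContinuousLinearMap.adjoint_inner_left Y (((Y†)) (Y x)) (Y x)
      rw [← inner_self_eq_zero (𝕜 := ℂ), this, a2, inner_zero_right]
    have := ContinuousLinearMap.adjoint_inner_left Y x (Y x)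
    rw [a3, inner_zero_left] at this
    simpa using inner_self_eq_zero.1 this.symm
  exact sub_eq_zero.1 hY0

theorem rowOp_defectOpStar (hT : IsRowContraction T) (x : HPow n H) :
    rowOp T (defectOpStar T x) = defectOp T (rowOp T x) := by
  have := intertwine_aux (defectOpStar_isPositive hT) (defectOp_isPositive hT) (rowOp T) (by
    ext x
    simp [defectOp_sq hT, defectOpStar_sq hT])
  exact congrArg (fun X : HPow n H →L[ℂ] H => X x) this

theorem rowOp_mem_defectSpace (hT : IsRowContraction T) (x : defectSpaceStar T) :
    rowOp T x ∈ defectSpace T := by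
  have hx : (x : HPow n H) ∈ closure ((defectOpStar T).range : Set (HPow n H)) := x.2
  refine map_mem_closure (rowOp T).continuous hx ?_
  rintro _ ⟨y, rfl⟩
  exact ⟨rowOp T y, (rowOp_defectOpStar hT y).symm⟩

/-- The restriction of the row operator `T` to an operator from `D_{T^*}` to `D_T`. -/
def rowDefect (hT : IsRowContraction T) : defectSpaceStar T →L[ℂ] defectSpace T :=
  (rowOp T ∘L (defectSpaceStar T).subtypeL).codRestrict (defectSpace T)
    (rowOp_mem_defectSpace hT)

theorem julia (hT : IsRowContraction T) (h : H) (x : HPow n H) :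
    ‖((rowOp T)†) h + defectOpStar T x‖ ^ 2 + ‖defectOp T h - rowOp T x‖ ^ 2 =
      ‖h‖ ^ 2 + ‖x‖ ^ 2 := by
  have hsa := (defectOp_isPositive hT).isSelfAdjoint.adjoint_eq
  have hta := (defectOpStar_isPositive hT).isSelfAdjoint.adjoint_eq
  have c : ⟪((rowOp T)†) h, defectOpStar T x⟫_ℂ = ⟪defectOp T h, rowOp T x⟫_ℂ := by
    rw [ContinuousLinearMap.adjoint_inner_left, rowOp_defectOpStar hT,
      ← ContinuousLinearMap.adjoint_inner_left, hsa]
  have e1 : ‖defectOp T h‖ ^ 2 = ‖h‖ ^ 2 - ‖((rowOp T)†) h‖ ^ 2 := by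
    have : ⟪defectOp T h, defectOp T h⟫_ℂ =
        ⟪h, h⟫_ℂ - ⟪((rowOp T)†) h, ((rowOp T)†) h⟫_ℂ := by
      rw [← ContinuousLinearMap.adjoint_inner_right, hsa, defectOp_sq hT, inner_sub_right,
        ContinuousLinearMap.adjoint_inner_left]
    simpa only [map_sub, inner_self_eq_norm_sq] using congrArg (RCLike.re : ℂ → ℝ) this
  have e2 : ‖defectOpStar T x‖ ^ 2 = ‖x‖ ^ 2 - ‖rowOp T x‖ ^ 2 := by
    have : ⟪defectOpStar T x, defectOpStar T x⟫_ℂ =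
        ⟪x, x⟫_ℂ - ⟪rowOp T x, rowOp T x⟫_ℂ := by
      rw [← ContinuousLinearMap.adjoint_inner_right, hta, defectOpStar_sq hT, inner_sub_right,
        ContinuousLinearMap.adjoint_inner_right]
    simpa only [map_sub, inner_self_eq_norm_sq] using congrArg (RCLike.re : ℂ → ℝ) this
  rw [norm_add_sq (𝕜 := ℂ), norm_sub_sq (𝕜 := ℂ), c, e1, e2]
  ring

end Row
/-! ### The constrained characteristic function -/

section CharFun

variable {n : ℕ} {K K' : Type*}
  [NormedAddCommGroup K] [InnerProductSpace ℂ K] [CompleteSpace K]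
  [NormedAddCommGroup K'] [InnerProductSpace ℂ K'] [CompleteSpace K']

theorem shiftAlong_comm {σ τ : Word n → Word n} (hσ : Function.Injective σ)
    (hτ : Function.Injective τ) (h : ∀ a, σ (τ a) = τ (σ a)) (x : Fock n K) :
    shiftAlong K σ hσ (shiftAlong K τ hτ x) = shiftAlong K τ hτ (shiftAlong K σ hσ x) := by
  have key : ∀ {σ τ : Word n → Word n} (hσ : Function.Injective σ) (hτ : Function.Injective τ)
      (x : Fock n K), shiftAlong K σ hσ (shiftAlong K τ hτ x) =
        shiftAlong K (σ ∘ τ) (hσ.comp hτ) x := by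
    intro σ τ hσ hτ x
    ext a
    by_cases h1 : ∃ b, σ b = a
    · obtain ⟨b, rfl⟩ := h1
      rw [shiftAlong_apply]
      by_cases h2 : ∃ c, τ c = b
      · obtain ⟨c, rfl⟩ := h2
        rw [shiftAlong_apply]
        exact (shiftAlong_apply (hσ.comp hτ) x c).symm
      · rw [shiftAlong_apply' _ _ _ h2, shiftAlong_apply']
        rintro ⟨c, hc⟩
        exact h2 ⟨c, hσ hc⟩
    · rw [shiftAlong_apply' _ _ _ h1, shiftAlong_apply']
      rintro ⟨c, hc⟩
      exact h1 ⟨_, hc⟩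
  rw [key, key]
  congr 2
  funext a
  exact h a

theorem right_left_comm (i j : Fin n) (x : Fock n K) :
    rightCreation K i (leftCreation K j x) = leftCreation K j (rightCreation K i x) :=
  shiftAlong_comm (mul_left_injective (FreeMonoid.of i)) (mul_right_injective (FreeMonoid.of j))
    (fun _ => mul_assoc _ _ _) x

theorem toeplitz_right_comm (f : toeplitzAlgebra n) (i : Fin n) (x : FockSpace n) :
    f.1 (rightCreation ℂ i x) = rightCreation ℂ i (f.1 x) := by
  have hle : toeplitzAlgebra n ≤ Subalgebra.centralizer ℂ
      {ContinuousLinearMapWOT.ofCLM (rightCreation ℂ i)} := by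
    refine Subalgebra.topologicalClosure_minimal (Algebra.adjoin_le ?_)
      (Set.isClosed_centralizer _)
    rintro _ ⟨j, rfl⟩
    rw [SetLike.mem_coe, Subalgebra.mem_centralizer_iff]
    rintro _ rfl
    exact ContinuousLinearMapWOT.ext fun y => right_left_comm i j y
  have := hle f.2
  rw [Subalgebra.mem_centralizer_iff] at this
  exact (congrArg (fun A : FockSpace n →WOT[ℂ] FockSpace n => A x) (this _ rfl)).symm

theorem inner_shiftAlong {σ : Word n → Word n} (hσ : Function.Injective σ) (x y : Fock n K) :
    ⟪x, shiftAlong K σ hσ y⟫_ℂ = ∑' a, ⟪x (σ a), y a⟫_ℂ := by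
  rw [lp.inner_eq_tsum, ← tsum_extend_zero hσ (fun a => ⟪x (σ a), y a⟫_ℂ)]
  congr 1
  funext a
  by_cases h : ∃ b, σ b = a
  · obtain ⟨b, rfl⟩ := h
    rw [hσ.extend_apply, shiftAlong_apply]
  · rw [Function.extend_apply' _ _ _ h, shiftAlong_apply' _ _ _ h, inner_zero_right]
    rfl

theorem rightCreation_adjoint_apply (i : Fin n) (f : FockSpace n) (a : Word n) :
    ((rightCreation ℂ i)†) f a = f (a * FreeMonoid.of i) := by
  have h1 : ⟪((rightCreation ℂ i)†) f, lp.single 2 a (1 : ℂ)⟫_ℂ =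
      ∑' b, ⟪f (b * FreeMonoid.of i), (lp.single 2 a (1 : ℂ) : FockSpace n) b⟫_ℂ := by
    rw [ContinuousLinearMap.adjoint_inner_left]
    exact inner_shiftAlong (mul_left_injective _) _ _
  rw [lp.inner_single_right, tsum_eq_single a] at h1
  · simpa using congrArg (starRingEnd ℂ) h1
  · intro b hb
    simp [lp.single_apply, hb]

variable (J : TwoSidedIdeal (toeplitzAlgebra n))

theorem mem_modelSpace_iff {f : FockSpace n} :
    f ∈ modelSpace J ↔ ∀ g ∈ J, ∀ x : FockSpace n, ⟪g.1 x, f⟫_ℂ = 0 := by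
  rw [modelSpace, idealSpace, Submodule.orthogonal_closure]
  constructor
  · intro h g hg x
    exact (Submodule.mem_orthogonal _ _).1 h _ (Submodule.subset_span ⟨g, hg, x, rfl⟩)
  · intro h
    rw [Submodule.mem_orthogonal]
    intro u hu
    induction hu using Submodule.span_induction with
    | mem u hu => obtain ⟨g, hg, x, rfl⟩ := hu; exact h g hg x
    | zero => simp
    | add u v _ _ hu hv => rw [inner_add_left, hu, hv, add_zero]
    | smul c u _ hu => rw [inner_smul_left, hu, mul_zero]

theorem rightCreation_adjoint_mem {f : FockSpace n} (hf : f ∈ modelSpace J) (i : Fin n) :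
    ((rightCreation ℂ i)†) f ∈ modelSpace J := by
  rw [mem_modelSpace_iff] at hf ⊢
  intro g hg x
  rw [ContinuousLinearMap.adjoint_inner_right, ← toeplitz_right_comm]
  exact hf g hg _

theorem mem_tensorSpace_orthogonal_iff {y : Fock n K} :
    y ∈ (tensorSpace J K)ᗮ ↔ ∀ f ∈ modelSpace J, ∀ k : K, ⟪tmul f k, y⟫_ℂ = 0 := by
  rw [tensorSpace, Submodule.orthogonal_closure]
  constructor
  · intro h f hf k
    exact (Submodule.mem_orthogonal _ _).1 h _ (Submodule.subset_span ⟨f, hf, k, rfl⟩)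
  · intro h
    rw [Submodule.mem_orthogonal]
    intro u hu
    induction hu using Submodule.span_induction with
    | mem u hu => obtain ⟨f, hf, k, rfl⟩ := hu; exact h f hf k
    | zero => simp
    | add u v _ _ hu hv => rw [inner_add_left, hu, hv, add_zero]
    | smul c u _ hu => rw [inner_smul_left, hu, mul_zero]

theorem ampl_coinvariant (X : K →L[ℂ] K') {y : Fock n K} (hy : y ∈ (tensorSpace J K)ᗮ) :
    ampl X y ∈ (tensorSpace J K')ᗮ := by
  rw [mem_tensorSpace_orthogonal_iff] at hy ⊢
  intro f hf k
  rw [← hy f hf ((X†) k), lp.inner_eq_tsum, lp.inner_eq_tsum]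
  congr 1
  funext a
  simp [inner_smul_left, ContinuousLinearMap.adjoint_inner_left]

theorem rightCreation_coinvariant (i : Fin n) {y : Fock n K} (hy : y ∈ (tensorSpace J K)ᗮ) :
    rightCreation K i y ∈ (tensorSpace J K)ᗮ := by
  rw [mem_tensorSpace_orthogonal_iff] at hy ⊢
  intro f hf k
  rw [← hy _ (rightCreation_adjoint_mem J hf i) k]
  refine (inner_shiftAlong (mul_left_injective (FreeMonoid.of i)) _ _).trans ?_
  rw [lp.inner_eq_tsum]
  congr 1
  funext a
  simp [rightCreation_adjoint_apply, inner_smul_left, mul_comm]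

theorem compress_apply_projection {M : Fock n K →L[ℂ] Fock n K'}
    (hM : ∀ y ∈ (tensorSpace J K)ᗮ, M y ∈ (tensorSpace J K')ᗮ) (x : Fock n K) :
    compress J M ((tensorSpace J K).orthogonalProjectionOnto x) =
      (tensorSpace J K').orthogonalProjectionOnto (M x) := by
  have h1 : x - (tensorSpace J K).starProjection x ∈ (tensorSpace J K)ᗮ :=
    Submodule.sub_starProjection_mem_orthogonal x
  have h2 := Submodule.orthogonalProjectionOnto_eq_zero_iff.2 (hM _ h1)
  rw [map_sub, map_sub, sub_eq_zero] at h2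
  exact h2.symm

/-! The unconstrained operators. -/

theorem ampl_norm_le (X : K →L[ℂ] K') : ‖(ampl X : Fock n K →L[ℂ] Fock n K')‖ ≤ ‖X‖ :=
  LinearMap.mkContinuous_norm_le _ (norm_nonneg _) _

variable {H : Type*} [NormedAddCommGroup H] [InnerProductSpace ℂ H] [CompleteSpace H]

/-- The row `[R_1 ⊗ I, …, R_n ⊗ I]`. -/
def fullRow (n : ℕ) (H : Type*) [NormedAddCommGroup H] [InnerProductSpace ℂ H] :
    Fock n (HPow n H) →L[ℂ] Fock n H :=
  ∑ i, rightCreation H i ∘L ampl (coordProj H i)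

theorem norm_fullRow (z : Fock n (HPow n H)) : ‖fullRow n H z‖ = ‖z‖ := by
  have hin : ⟪fullRow n H z, fullRow n H z⟫_ℂ =
      ∑ i, ⟪ampl (coordProj H i) z, ampl (coordProj H i) z⟫_ℂ := by
    simp only [fullRow, sum_apply, ContinuousLinearMap.comp_apply]
    rw [sum_inner]
    refine Finset.sum_congr rfl fun i _ => ?_
    rw [inner_sum, Finset.sum_eq_single i]
    · exact (shiftAlong H _ (mul_left_injective (FreeMonoid.of i))).inner_map_map _ _
    · intro j _ hj
      refine (inner_shiftAlong (mul_left_injective (FreeMonoid.of j)) _ _).trans ?_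
      convert tsum_zero using 2 with a
      funext a
      rw [show rightCreation H i ((ampl (coordProj H i)) z) (a * FreeMonoid.of j) = 0 from
        shiftAlong_apply' (mul_left_injective (FreeMonoid.of i)) _ _ ?_, inner_zero_left]
      rintro ⟨b, hb⟩
      have := congrArg (fun w : Word n => (FreeMonoid.toList w).getLast?) hb
      simp at this
      exact hj this.symm
    · simp
  have h2 : ∑ i, ⟪ampl (coordProj H i) z, ampl (coordProj H i) z⟫_ℂ = ⟪z, z⟫_ℂ := by
    simp_rw [lp.inner_eq_tsum, PiLp.inner_apply]
    rw [Summable.tsum_finsetSum]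
    · rfl
    · intro i _
      exact lp.summable_inner (𝕜 := ℂ) (ampl (coordProj H i) z) (ampl (coordProj H i) z)
  have h3 := congrArg (RCLike.re : ℂ → ℝ) (hin.trans h2)
  rw [inner_self_eq_norm_sq, inner_self_eq_norm_sq] at h3
  exact (sq_eq_sq₀ (norm_nonneg _) (norm_nonneg _)).1 h3


variable (T : Fin n → H →L[ℂ] H)

/-- The operator `∑ R_i ⊗ T_i^*`. -/
def fullState : Fock n H →L[ℂ] Fock n H := ∑ i, rightCreation H i ∘L ampl ((T i)†)

variable {T}

theorem fullState_apply (x : Fock n H) : fullState T x = fullRow n H (ampl ((rowOp T)†) x) := by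
  simp only [fullState, fullRow, sum_apply, ContinuousLinearMap.comp_apply]
  refine Finset.sum_congr rfl fun i _ => congrArg _ ?_
  ext a
  simp [proj_rowOp_adjoint]

theorem norm_fullState_le (hT : IsRowContraction T) : ‖fullState T‖ ≤ 1 := by
  refine ContinuousLinearMap.opNorm_le_bound _ zero_le_one fun x => ?_
  rw [fullState_apply, norm_fullRow, one_mul]
  refine (sq_le_sq₀ (norm_nonneg _) (norm_nonneg _)).1 ?_
  rw [norm_sq_eq, norm_sq_eq]
  refine Summable.tsum_le_tsum (fun a => ?_) (summable_sq _) (summable_sq x)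
  exact pow_le_pow_left₀ (norm_nonneg _) (norm_rowOp_adjoint_le hT (x a)) 2

theorem isUnit_one_sub {E : Type*} [NormedAddCommGroup E] [InnerProductSpace ℂ E]
    [CompleteSpace E] {A : E →L[ℂ] E} (hA : ‖A‖ ≤ 1) {r : ℝ} (h0 : 0 ≤ r) (h1 : r < 1) :
    IsUnit (1 - (r : ℂ) • A) := by
  refine isUnit_one_sub_of_norm_lt_one ?_
  rw [norm_smul, Complex.norm_real, Real.norm_of_nonneg h0]
  nlinarith [norm_nonneg A]

theorem inverse_apply_left {E : Type*} [NormedAddCommGroup E] [InnerProductSpace ℂ E]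
    {A : E →L[ℂ] E} (hA : IsUnit A) (x : E) : Ring.inverse A (A x) = x :=
  congrArg (fun X : E →L[ℂ] E => X x) (Ring.inverse_mul_cancel A hA)

theorem inverse_apply_right {E : Type*} [NormedAddCommGroup E] [InnerProductSpace ℂ E]
    {A : E →L[ℂ] E} (hA : IsUnit A) (x : E) : A (Ring.inverse A x) = x :=
  congrArg (fun X : E →L[ℂ] E => X x) (Ring.mul_inverse_cancel A hA)

/-- The dilation `e_α ⊗ k ↦ t^|α| e_α ⊗ k`. -/
def dil (K : Type*) [NormedAddCommGroup K] [InnerProductSpace ℂ K] (t : Set.Icc (0 : ℝ) 1) :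
    Fock n K →ₗ[ℂ] Fock n K where
  toFun x := ⟨fun a => ((t : ℂ) ^ a.length) • x a, (memlp_iff _).2 <|
    Summable.of_nonneg_of_le (fun a => by positivity) (fun a => by
      rw [norm_smul, norm_pow, Complex.norm_real, Real.norm_of_nonneg t.2.1]
      refine pow_le_pow_left₀ (by have := t.2.1; positivity) ?_ 2
      exact mul_le_of_le_one_left (norm_nonneg _) (pow_le_one₀ t.2.1 t.2.2)) (summable_sq x)⟩
  map_add' x y := by ext a; exact smul_add _ (x a) (y a)
  map_smul' c x := by ext a; exact smul_comm _ c (x a)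

theorem dil_apply (t : Set.Icc (0 : ℝ) 1) (x : Fock n K) (a : Word n) :
    dil K t x a = ((t : ℂ) ^ a.length) • x a := rfl

theorem dil_ampl (t : Set.Icc (0 : ℝ) 1) (X : K →L[ℂ] K') (x : Fock n K) :
    dil K' t (ampl X x) = ampl X (dil K t x) := by
  ext a
  simp [dil_apply]

theorem dil_right (t : Set.Icc (0 : ℝ) 1) (i : Fin n) (x : Fock n K) :
    dil K t (rightCreation K i x) = (t : ℂ) • rightCreation K i (dil K t x) := by
  have hσ := mul_left_injective (FreeMonoid.of i)
  ext a
  by_cases h : ∃ b, b * FreeMonoid.of i = a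
  · obtain ⟨b, rfl⟩ := h
    have e1 : rightCreation K i x (b * FreeMonoid.of i) = x b := shiftAlong_apply hσ x b
    have e2 : rightCreation K i (dil K t x) (b * FreeMonoid.of i) = dil K t x b :=
      shiftAlong_apply hσ _ b
    rw [dil_apply, e1, lp.coeFn_smul, Pi.smul_apply, e2, dil_apply, smul_smul]
    simp [FreeMonoid.length_mul, pow_succ, mul_comm]
  · have e1 : rightCreation K i x a = 0 := shiftAlong_apply' hσ x a h
    have e2 : rightCreation K i (dil K t x) a = 0 := shiftAlong_apply' hσ _ a h
    rw [dil_apply, e1, lp.coeFn_smul, Pi.smul_apply, e2, smul_zero, smul_zero]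

theorem dil_fullRow (t : Set.Icc (0 : ℝ) 1) (x : Fock n (HPow n H)) :
    dil H t (fullRow n H x) = (t : ℂ) • fullRow n H (dil _ t x) := by
  simp only [fullRow, sum_apply, ContinuousLinearMap.comp_apply, map_sum, dil_right, dil_ampl,
    Finset.smul_sum]

theorem dil_fullState (t : Set.Icc (0 : ℝ) 1) (x : Fock n H) :
    dil H t (fullState T x) = (t : ℂ) • fullState T (dil _ t x) := by
  rw [fullState_apply, fullState_apply, dil_fullRow, dil_ampl]


/-! The limit `r → 1` for the transfer function of a contractive colligation
`H ⊕ D' → E ⊕ D` with entries `B`, `Z`, `Y`, `-X`. -/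

section Generic

variable {E D D' : Type*}
  [NormedAddCommGroup E] [InnerProductSpace ℂ E] [CompleteSpace E]
  [NormedAddCommGroup D] [InnerProductSpace ℂ D] [CompleteSpace D]
  [NormedAddCommGroup D'] [InnerProductSpace ℂ D'] [CompleteSpace D']

/-- `-(I ⊗ X) + (I ⊗ Y) (I - rA)^{-1} rG (I ⊗ Z)`. -/
def radial (A : Fock n H →L[ℂ] Fock n H) (G : Fock n E →L[ℂ] Fock n H)
    (X : D' →L[ℂ] D) (Y : H →L[ℂ] D) (Z : D' →L[ℂ] E) (r : ℝ) : Fock n D' →L[ℂ] Fock n D :=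
  -ampl X + ampl Y ∘L Ring.inverse (1 - (r : ℂ) • A) ∘L ((r : ℂ) • G) ∘L ampl Z

variable {A : Fock n H →L[ℂ] Fock n H} {G : Fock n E →L[ℂ] Fock n H}
  {X : D' →L[ℂ] D} {Y : H →L[ℂ] D} {Z : D' →L[ℂ] E} {B : H →L[ℂ] E}

theorem radial_apply (r : ℝ) (x : Fock n D') : radial A G X Y Z r x =
    -ampl X x + ampl Y (Ring.inverse (1 - (r : ℂ) • A) ((r : ℂ) • G (ampl Z x))) := rfl

theorem radial_norm_le (hA : ‖A‖ ≤ 1) (hAG : ∀ x, A x = G (ampl B x)) (hG : ∀ z, ‖G z‖ = ‖z‖)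
    (hJ : ∀ h x, ‖B h + Z x‖ ^ 2 + ‖-X x + Y h‖ ^ 2 = ‖h‖ ^ 2 + ‖x‖ ^ 2)
    {r : ℝ} (h0 : 0 ≤ r) (h1 : r < 1) (x : Fock n D') : ‖radial A G X Y Z r x‖ ≤ ‖x‖ := by
  rw [radial_apply]
  have hu1 := isUnit_one_sub hA h0 h1
  have hinv := inverse_apply_right hu1 ((r : ℂ) • G (ampl Z x))
  generalize Ring.inverse (1 - (r : ℂ) • A) ((r : ℂ) • G (ampl Z x)) = h at hinv ⊢
  have e1 : h = (r : ℂ) • G (ampl B h + ampl Z x) := by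
    simp only [sub_apply, one_apply_eq_self, smul_apply, hAG] at hinv
    rw [map_add, smul_add, ← hinv]
    abel
  have e2 : ‖h‖ ^ 2 ≤ ‖ampl B h + ampl Z x‖ ^ 2 := by
    refine pow_le_pow_left₀ (norm_nonneg _) ?_ 2
    conv_lhs => rw [e1]
    rw [norm_smul, hG, Complex.norm_real, Real.norm_of_nonneg h0]
    exact mul_le_of_le_one_left (norm_nonneg _) h1.le
  have e3 : ‖ampl B h + ampl Z x‖ ^ 2 + ‖-ampl X x + ampl Y h‖ ^ 2 = ‖h‖ ^ 2 + ‖x‖ ^ 2 := by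
    rw [norm_sq_eq, norm_sq_eq, norm_sq_eq, norm_sq_eq,
      ← Summable.tsum_add (summable_sq _) (summable_sq _),
      ← Summable.tsum_add (summable_sq _) (summable_sq _)]
    congr 1
    funext a
    exact hJ (h a) (x a)
  refine (sq_le_sq₀ (norm_nonneg _) (norm_nonneg _)).1 ?_
  linarith

theorem dil_radial (hA : ‖A‖ ≤ 1) (hdA : ∀ t x, dil H t (A x) = (t : ℂ) • A (dil H t x))
    (hdG : ∀ t x, dil H t (G x) = (t : ℂ) • G (dil E t x))
    (t : Set.Icc (0 : ℝ) 1) {s : ℝ} (h0 : 0 ≤ s) (h1 : s < 1) (x : Fock n D') :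
    dil D t (radial A G X Y Z s x) = radial A G X Y Z (t * s) (dil D' t x) := by
  have hu := isUnit_one_sub hA h0 h1
  have hu' := isUnit_one_sub hA (mul_nonneg t.2.1 h0)
    ((mul_le_of_le_one_left h0 t.2.2).trans_lt h1)
  have key : ∀ y : Fock n H, dil H t (Ring.inverse (1 - (s : ℂ) • A) y) =
      Ring.inverse (1 - ((t * s : ℝ) : ℂ) • A) (dil H t y) := by
    intro y
    have hy := inverse_apply_right hu y
    generalize Ring.inverse (1 - (s : ℂ) • A) y = z at hy ⊢
    have : dil H t y = (1 - ((t * s : ℝ) : ℂ) • A) (dil H t z) := by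
      rw [← hy]
      simp only [sub_apply, one_apply_eq_self, smul_apply, map_sub, map_smul, hdA,
        smul_smul, Complex.ofReal_mul, mul_comm]
    rw [this, inverse_apply_left hu']
  rw [radial_apply, radial_apply, map_add, map_neg, dil_ampl, dil_ampl, key, map_smul, hdG,
    dil_ampl, smul_smul, Complex.ofReal_mul, mul_comm]

theorem tendsto_dil (x : Fock n K) {t : ℝ → Set.Icc (0 : ℝ) 1}
    (ht : Tendsto (fun r => (t r : ℝ)) (𝓝[<] 1) (𝓝 1)) :
    Tendsto (fun r => dil K (t r) x) (𝓝[<] 1) (𝓝 x) := by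
  rw [tendsto_iff_norm_sub_tendsto_zero]
  have h : Tendsto (fun r => ‖dil K (t r) x - x‖ ^ 2) (𝓝[<] 1) (𝓝 0) := by
    simp_rw [norm_sq_eq]
    rw [show (0 : ℝ) = ∑' _ : Word n, (0 : ℝ) by simp]
    refine tendsto_tsum_of_dominated_convergence (summable_sq x) (fun a => ?_)
      (Eventually.of_forall fun r a => ?_)
    · have h1 : Tendsto (fun r => dil K (t r) x a) (𝓝[<] 1) (𝓝 (x a)) := by
        have : Tendsto (fun r => (((t r : ℝ) ^ a.length : ℝ) : ℂ)) (𝓝[<] 1) (𝓝 1) := by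
          have := (Complex.continuous_ofReal.tendsto _).comp (ht.pow a.length)
          simpa [Function.comp_def] using this
        have := this.smul_const (x a)
        simpa [dil_apply] using this
      have := ((h1.sub_const (x a)).norm).pow 2
      simpa using this
    · have ht1 := (t r).2
      have e : (dil K (t r) x - x) a = ((((t r : ℝ) ^ a.length - 1 : ℝ) : ℂ)) • x a := by
        simp [dil_apply, sub_smul]
      rw [e, norm_smul, Complex.norm_real, Real.norm_of_nonneg (by positivity)]
      refine pow_le_pow_left₀ (by positivity) (mul_le_of_le_one_left (norm_nonneg _) ?_) 2
      have h0 : 0 ≤ (t r : ℝ) ^ a.length := pow_nonneg ht1.1 _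
      have h1 : (t r : ℝ) ^ a.length ≤ 1 := pow_le_one₀ ht1.1 ht1.2
      rw [Real.norm_eq_abs, abs_le]
      constructor <;> linarith
  have := h.sqrt
  simpa [Real.sqrt_sq] using this

theorem continuousAt_radial (hA : ‖A‖ ≤ 1) {r : ℝ} (h0 : 0 ≤ r) (h1 : r < 1) (x : Fock n D') :
    ContinuousAt (fun s => radial A G X Y Z s x) r := by
  obtain ⟨u, hu⟩ := isUnit_one_sub hA h0 h1
  have c1 : ContinuousAt (fun s : ℝ => Ring.inverse (1 - (s : ℂ) • A)) r := by
    have := NormedRing.inverse_continuousAt u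
    rw [hu] at this
    exact ContinuousAt.comp (f := fun s : ℝ => 1 - (s : ℂ) • A) this
      (continuous_const.sub (Complex.continuous_ofReal.smul continuous_const)).continuousAt
  have c2 : ContinuousAt (fun s : ℝ => (s : ℂ) • G (ampl Z x)) r :=
    (Complex.continuous_ofReal.smul continuous_const).continuousAt
  simp only [radial_apply]
  exact continuousAt_const.add ((ampl Y).continuous.continuousAt.comp (c1.clm_apply c2))

theorem eventually_left : ∀ᶠ r in 𝓝[<] (1 : ℝ), 0 ≤ r ∧ r < 1 := by
  filter_upwards [Ioo_mem_nhdsLT (zero_lt_one (α := ℝ))] with r hr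
  exact ⟨hr.1.le, hr.2⟩

theorem exists_radial_limit (hA : ‖A‖ ≤ 1) (hAG : ∀ x, A x = G (ampl B x))
    (hG : ∀ z, ‖G z‖ = ‖z‖)
    (hJ : ∀ h x, ‖B h + Z x‖ ^ 2 + ‖-X x + Y h‖ ^ 2 = ‖h‖ ^ 2 + ‖x‖ ^ 2)
    (hdA : ∀ t x, dil H t (A x) = (t : ℂ) • A (dil H t x))
    (hdG : ∀ t x, dil H t (G x) = (t : ℂ) • G (dil E t x)) :
    ∃ Θ : Fock n D' →L[ℂ] Fock n D,
      ∀ x, Tendsto (fun r => radial A G X Y Z r x) (𝓝[<] 1) (𝓝 (Θ x)) := by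
  have hid : Tendsto (fun r : ℝ => r) (𝓝[<] 1) (𝓝 1) := tendsto_id.mono_left nhdsWithin_le_nhds
  have hdil : ∀ (t : Set.Icc (0 : ℝ) 1) (x : Fock n D'), (t : ℝ) < 1 →
      Tendsto (fun s => dil D t (radial A G X Y Z s x)) (𝓝[<] 1)
        (𝓝 (radial A G X Y Z t (dil D' t x))) := by
    intro t x ht
    have h1 := (continuousAt_radial (G := G) (X := X) (Y := Y) (Z := Z) hA t.2.1 ht
      (dil D' t x)).tendsto
    have h2 : Tendsto (fun s : ℝ => (t : ℝ) * s) (𝓝[<] 1) (𝓝 t) := by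
      simpa using hid.const_mul (t : ℝ)
    refine (h1.comp h2).congr' ?_
    filter_upwards [eventually_left] with s hs
    exact (dil_radial hA hdA hdG t hs.1 hs.2 x).symm
  have heval : ∀ a : Word n, Continuous fun y : Fock n D => y a := fun a =>
    (lp.evalCLM (𝕜 := ℂ) (fun _ : Word n => D) 2 a).continuous
  have hcoord : ∀ (x : Fock n D') (a : Word n),
      ∃ c : D, Tendsto (fun s => radial A G X Y Z s x a) (𝓝[<] 1) (𝓝 c) := by
    intro x a
    let t : Set.Icc (0 : ℝ) 1 := ⟨1 / 2, by norm_num, by norm_num⟩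
    have h1 := ((heval a).tendsto _).comp (hdil t x (by norm_num [t]))
    have h2 := h1.const_smul ((2 : ℂ) ^ a.length)
    refine ⟨_, h2.congr fun s => ?_⟩
    simp only [Function.comp_apply, dil_apply, smul_smul, ← mul_pow]
    norm_num [t]
  choose c hc using hcoord
  have hseq : Tendsto (fun k : ℕ => (1 : ℝ) - 1 / ((k : ℝ) + 1)) atTop (𝓝[<] 1) := by
    refine tendsto_nhdsWithin_iff.2 ⟨?_, Eventually.of_forall fun k => ?_⟩
    · simpa using (tendsto_one_div_add_atTop_nhds_zero_nat (𝕜 := ℝ)).const_sub 1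
    · have : (0 : ℝ) < 1 / ((k : ℝ) + 1) := by positivity
      simpa using this
  have hmem : ∀ x, Memℓp (c x) 2 := by
    intro x
    refine lp.memℓp_of_tendsto (l := atTop)
      (F := fun k : ℕ => radial A G X Y Z (1 - 1 / ((k : ℝ) + 1)) x) ?_ ?_
    · refine isBounded_iff_forall_norm_le.2 ⟨‖x‖, ?_⟩
      rintro _ ⟨k, rfl⟩
      refine radial_norm_le hA hAG hG hJ ?_ ?_ x
      · rw [sub_nonneg, div_le_one (by positivity)]
        linarith [(Nat.cast_nonneg k : (0 : ℝ) ≤ k)]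
      · have : (0 : ℝ) < 1 / ((k : ℝ) + 1) := by positivity
        linarith
    · exact tendsto_pi_nhds.2 fun a => (hc x a).comp hseq
  let y : Fock n D' → Fock n D := fun x => ⟨c x, hmem x⟩
  have hdy : ∀ (t : Set.Icc (0 : ℝ) 1) (x : Fock n D'), (t : ℝ) < 1 →
      dil D t (y x) = radial A G X Y Z t (dil D' t x) := by
    intro t x ht
    ext a
    refine tendsto_nhds_unique ?_ (((heval a).tendsto _).comp (hdil t x ht))
    exact (hc x a).const_smul ((t : ℂ) ^ a.length)
  have hlim : ∀ x, Tendsto (fun r => radial A G X Y Z r x) (𝓝[<] 1) (𝓝 (y x)) := by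
    intro x
    let t : ℝ → Set.Icc (0 : ℝ) 1 := Set.projIcc 0 1 zero_le_one
    have ht : ∀ᶠ r in 𝓝[<] (1 : ℝ), (t r : ℝ) = r := by
      filter_upwards [eventually_left] with r hr
      exact congrArg Subtype.val (Set.projIcc_of_mem zero_le_one ⟨hr.1, hr.2.le⟩)
    have ht' : Tendsto (fun r => (t r : ℝ)) (𝓝[<] 1) (𝓝 1) :=
      hid.congr' (ht.mono fun r hr => hr.symm)
    have h1 := tendsto_dil x ht'
    have h2 := tendsto_dil (y x) ht'
    have h3 : Tendsto (fun r => radial A G X Y Z r (x - dil D' (t r) x)) (𝓝[<] 1) (𝓝 0) := by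
      refine squeeze_zero_norm' (a := fun r => ‖x - dil D' (t r) x‖) ?_ ?_
      · filter_upwards [eventually_left] with r hr
        exact radial_norm_le hA hAG hG hJ hr.1 hr.2 _
      · simpa using (h1.const_sub x).norm
    have h4 := h3.add h2
    rw [zero_add] at h4
    refine h4.congr' ?_
    filter_upwards [eventually_left, ht] with r hr htr
    rw [hdy (t r) x (by rw [htr]; exact hr.2), htr, map_sub, sub_add_cancel]
  refine ⟨LinearMap.mkContinuous
    { toFun := y
      map_add' := fun u v => ?_
      map_smul' := fun z u => ?_ } 1 (fun x => ?_), hlim⟩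
  · refine tendsto_nhds_unique (hlim (u + v)) ?_
    simpa only [map_add] using (hlim u).add (hlim v)
  · refine tendsto_nhds_unique (hlim (z • u)) ?_
    simpa only [map_smul, RingHom.id_apply] using (hlim u).const_smul z
  · refine le_of_tendsto (hlim x).norm ?_
    filter_upwards [eventually_left] with r hr
    rw [one_mul]
    exact radial_norm_le hA hAG hG hJ hr.1 hr.2 _

theorem constrainedAmpl_projection (X : K →L[ℂ] K') (x : Fock n K) :
    constrainedAmpl J X ((tensorSpace J K).orthogonalProjectionOnto x) =
      (tensorSpace J K').orthogonalProjectionOnto (ampl X x) :=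
  compress_apply_projection J (fun _ hy => ampl_coinvariant J X hy) x

theorem constrainedRight_projection (i : Fin n) (X : K →L[ℂ] K') (x : Fock n K) :
    constrainedRight J i X ((tensorSpace J K).orthogonalProjectionOnto x) =
      (tensorSpace J K').orthogonalProjectionOnto (rightCreation K' i (ampl X x)) :=
  compress_apply_projection J (M := rightCreation K' i ∘L ampl X)
    (fun _ hy => rightCreation_coinvariant J i (ampl_coinvariant J X hy)) x

theorem radial_projection {r : ℝ} {A' : tensorSpace J H →L[ℂ] tensorSpace J H}
    {G' : tensorSpace J E →L[ℂ] tensorSpace J H} (hu : IsUnit (1 - (r : ℂ) • A))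
    (hu' : IsUnit (1 - (r : ℂ) • A'))
    (hA' : ∀ y, A' ((tensorSpace J H).orthogonalProjectionOnto y) =
      (tensorSpace J H).orthogonalProjectionOnto (A y))
    (hG' : ∀ z, G' ((tensorSpace J E).orthogonalProjectionOnto z) =
      (tensorSpace J H).orthogonalProjectionOnto (G z)) (x : Fock n D') :
    (-constrainedAmpl J X + constrainedAmpl J Y ∘L Ring.inverse (1 - (r : ℂ) • A') ∘L
      ((r : ℂ) • G') ∘L constrainedAmpl J Z) ((tensorSpace J D').orthogonalProjectionOnto x) =
      (tensorSpace J D).orthogonalProjectionOnto (radial A G X Y Z r x) := by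
  have key : ∀ y : Fock n H, Ring.inverse (1 - (r : ℂ) • A')
      ((tensorSpace J H).orthogonalProjectionOnto y) =
        (tensorSpace J H).orthogonalProjectionOnto (Ring.inverse (1 - (r : ℂ) • A) y) := by
    intro y
    have hy := inverse_apply_right hu y
    generalize Ring.inverse (1 - (r : ℂ) • A) y = z at hy ⊢
    have : (tensorSpace J H).orthogonalProjectionOnto y =
        (1 - (r : ℂ) • A') ((tensorSpace J H).orthogonalProjectionOnto z) := by
      rw [← hy]
      simp only [sub_apply, one_apply_eq_self, smul_apply, hA', map_sub, map_smul]
    rw [this, inverse_apply_left hu']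
  rw [radial_apply]
  simp only [add_apply, neg_apply, ContinuousLinearMap.comp_apply, smul_apply,
    constrainedAmpl_projection, hG', map_add, map_neg]
  rw [← map_smul, key, constrainedAmpl_projection]

end Generic

/-- The operator
`-I ⊗ T + (I ⊗ Δ_T) (I - ∑ rW_i ⊗ T_i^*)^{-1} [rW_1 ⊗ I, …, rW_n ⊗ I] (I ⊗ Δ_{T^*})`
from `N_J ⊗ D_{T^*}` to `N_J ⊗ D_T`, for `0 ≤ r < 1` (when the inverse exists). -/
def charFunRadial (hT : IsRowContraction T) (r : ℝ) :
    tensorSpace J (defectSpaceStar T) →L[ℂ] tensorSpace J (defectSpace T) :=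
  -constrainedAmpl J (rowDefect hT) +
    constrainedAmpl J (defectCod T) ∘L
      Ring.inverse (1 - (r : ℂ) • ∑ i, constrainedRight J i ((T i)†)) ∘L
      ((r : ℂ) • ∑ i, constrainedRight J i (coordProj H i)) ∘L
      constrainedAmpl J (defectStarDom T)

/-- `Θ` has the formal Fourier representation
`-I ⊗ T + (I ⊗ Δ_T) (I - ∑ W_i ⊗ T_i^*)^{-1} [W_1 ⊗ I, …, W_n ⊗ I] (I ⊗ Δ_{T^*})`:
it is the limit, in the strong operator topology and as `r → 1`, of the operators obtained by
replacing `W_i` with `rW_i`. -/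
def IsConstrainedCharFun (hT : IsRowContraction T)
    (Θ : tensorSpace J (defectSpaceStar T) →L[ℂ] tensorSpace J (defectSpace T)) : Prop :=
  ∀ x, Tendsto (fun r : ℝ => charFunRadial J hT r x) (𝓝[<] 1) (𝓝 (Θ x))

theorem isUnit_constrained (hT : IsRowContraction T) {r : ℝ} (h0 : 0 ≤ r) (h1 : r < 1) :
    IsUnit (1 - (r : ℂ) • ∑ i, constrainedRight J i ((T i)†)) := by
  refine isUnit_one_sub ?_ h0 h1
  have e : ∑ i, constrainedRight J i ((T i)†) = compress J (fullState T) := by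
    ext1 x
    simp [constrainedRight, compress, fullState, sum_apply]
  rw [e]
  refine ContinuousLinearMap.opNorm_le_bound _ zero_le_one fun x => ?_
  refine ((tensorSpace J H).norm_orthogonalProjectionOnto_apply_le _).trans ?_
  exact (fullState T).le_of_opNorm_le (norm_fullState_le hT) _

theorem sum_constrainedRight_adjoint (y : Fock n H) :
    (∑ i, constrainedRight J i ((T i)†)) ((tensorSpace J H).orthogonalProjectionOnto y) =
      (tensorSpace J H).orthogonalProjectionOnto (fullState T y) := by
  rw [sum_apply, fullState, sum_apply, map_sum]
  exact Finset.sum_congr rfl fun i _ => constrainedRight_projection J i _ y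

theorem sum_constrainedRight_proj (z : Fock n (HPow n H)) :
    (∑ i, constrainedRight J i (coordProj H i))
      ((tensorSpace J (HPow n H)).orthogonalProjectionOnto z) =
      (tensorSpace J H).orthogonalProjectionOnto (fullRow n H z) := by
  rw [sum_apply, fullRow, sum_apply, map_sum]
  exact Finset.sum_congr rfl fun i _ => constrainedRight_projection J i _ z

/-- The constrained operators are the compressions of the unconstrained ones. -/
theorem charFunRadial_projection (hT : IsRowContraction T) {r : ℝ} (h0 : 0 ≤ r) (h1 : r < 1)
    (x : Fock n (defectSpaceStar T)) :
    charFunRadial J hT r ((tensorSpace J (defectSpaceStar T)).orthogonalProjectionOnto x) =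
      (tensorSpace J (defectSpace T)).orthogonalProjectionOnto
        (radial (fullState T) (fullRow n H) (rowDefect hT) (defectCod T) (defectStarDom T) r x) := by
  have h2 : IsUnit (1 - (r : ℂ) • fullState T) :=
    isUnit_one_sub (E := Fock n H) (A := fullState T) (norm_fullState_le hT) h0 h1
  have h3 := isUnit_constrained J hT h0 h1
  unfold charFunRadial
  generalize rowDefect hT = X
  generalize defectCod T = Y
  generalize defectStarDom T = Z
  refine radial_projection J (H := H) (E := HPow n H) (D := defectSpace T) (D' := defectSpaceStar T) (A := fullState T) (G := fullRow n H) (X := X) (Y := Y) (Z := Z) (A' := ∑ i, constrainedRight J i ((T i)†)) (G' := ∑ i, constrainedRight J i (coordProj H i)) ?_ ?_ ?_ ?_ x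
  · exact h2
  · exact h3
  · exact sum_constrainedRight_adjoint J
  · exact sum_constrainedRight_proj J

theorem exists_constrainedCharFun (hT : IsRowContraction T) :
    ∃ Θ, IsConstrainedCharFun J hT Θ := by
  obtain ⟨Θ, hΘ⟩ := exists_radial_limit (A := fullState T) (G := fullRow n H)
    (X := rowDefect hT) (Y := defectCod T) (Z := defectStarDom T) (B := (rowOp T)†)
    (norm_fullState_le hT) fullState_apply norm_fullRow
    (fun h x => by
      have := julia hT h (x : HPow n H)
      rw [sub_eq_neg_add] at this
      exact this) dil_fullState dil_fullRow
  refine ⟨compress J Θ, fun x => ?_⟩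
  have h := ((tensorSpace J (defectSpace T)).orthogonalProjectionOnto.continuous.tendsto _).comp
    (hΘ x)
  refine h.congr' ?_
  filter_upwards [eventually_left] with r hr
  have := charFunRadial_projection J hT hr.1 hr.2 (x : Fock n (defectSpaceStar T))
  rw [Submodule.orthogonalProjectionOnto_mem_subspace_eq_self] at this
  exact this.symm

/-- The constrained characteristic function `Θ_{J,T} : N_J ⊗ D_{T^*} → N_J ⊗ D_T`. -/
def constrainedCharFun (hT : IsRowContraction T) :
    tensorSpace J (defectSpaceStar T) →L[ℂ] tensorSpace J (defectSpace T) :=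
  (exists_constrainedCharFun J hT).choose

theorem constrainedCharFun_spec (hT : IsRowContraction T) :
    IsConstrainedCharFun J hT (constrainedCharFun J hT) :=
  (exists_constrainedCharFun J hT).choose_spec

/-! On elementary tensors, `constrainedRight J i X` is `(P_{N_J} R_i |_{N_J}) ⊗ X`. -/

instance : CompleteSpace (modelSpace J) :=
  (Submodule.isClosed_orthogonal (idealSpace J)).completeSpace_coe

instance : (modelSpace J).HasOrthogonalProjection :=
  Submodule.HasOrthogonalProjection.ofCompleteSpace _

theorem tmul_mem {f : FockSpace n} (hf : f ∈ modelSpace J) (k : K) : tmul f k ∈ tensorSpace J K :=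
  Submodule.le_topologicalClosure _ (Submodule.subset_span ⟨f, hf, k, rfl⟩)

theorem starProjection_tmul (g : FockSpace n) (k : K) :
    (tensorSpace J K).starProjection (tmul g k) = tmul ((modelSpace J).starProjection g) k := by
  refine Submodule.eq_starProjection_of_mem_orthogonal
    (tmul_mem J (Submodule.starProjection_apply_mem _ _) k) ?_
  rw [mem_tensorSpace_orthogonal_iff]
  intro f hf k'
  have h := (Submodule.mem_orthogonal _ _).1
    (Submodule.sub_starProjection_mem_orthogonal (K := modelSpace J) g) f hf
  have e : tmul g k - tmul ((modelSpace J).starProjection g) k =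
      tmul (g - (modelSpace J).starProjection g) k := by
    ext a
    simp [sub_smul]
  rw [e, lp.inner_eq_tsum]
  rw [lp.inner_eq_tsum] at h
  have e2 : ∀ a, ⟪tmul f k' a, tmul (g - (modelSpace J).starProjection g) k a⟫_ℂ =
      ⟪f a, (g - (modelSpace J).starProjection g) a⟫_ℂ * ⟪k', k⟫_ℂ := by
    intro a
    simp only [tmul_apply, inner_smul_left, inner_smul_right, RCLike.inner_apply]
    ring
  simp_rw [e2]
  rw [tsum_mul_right, h, zero_mul]

theorem constrainedRight_tmul (i : Fin n) (X : K →L[ℂ] K') {f : FockSpace n}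
    (hf : f ∈ modelSpace J) (k : K) :
    (constrainedRight J i X ⟨tmul f k, tmul_mem J hf k⟩ : Fock n K') =
      tmul ((modelSpace J).starProjection (rightCreation ℂ i f)) (X k) := by
  rw [← starProjection_tmul]
  change (tensorSpace J K').starProjection (rightCreation K' i (ampl X (tmul f k))) = _
  congr 1
  have hσ := mul_left_injective (FreeMonoid.of i)
  ext a
  by_cases h : ∃ b, b * FreeMonoid.of i = a
  · obtain ⟨b, rfl⟩ := h
    have e1 : rightCreation K' i (ampl X (tmul f k)) (b * FreeMonoid.of i) =
        ampl X (tmul f k) b := shiftAlong_apply hσ _ b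
    have e2 : rightCreation ℂ i f (b * FreeMonoid.of i) = f b := shiftAlong_apply hσ f b
    rw [e1, tmul_apply, e2]
    simp
  · have e1 : rightCreation K' i (ampl X (tmul f k)) a = 0 := shiftAlong_apply' hσ _ a h
    have e2 : rightCreation ℂ i f a = 0 := shiftAlong_apply' hσ f a h
    rw [e1, tmul_apply, e2, zero_smul]

end CharFun
end NCFock
end

open NCFock

/-!
Write `Θ` for the characteristic function of `T` on the whole Fock space and
`K h = ∑ e_α ⊗ Δ_T T_α^* h` for the Poisson kernel, a contraction from `H` to `F²(H_n) ⊗ D_T`.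
The proof rests on the factorization `I - Θ Θ^* = K K^*`, in the form
`‖Θ^* x‖² + ‖K^* x‖² = ‖x‖²` (`IsCharFun.norm_adjoint`). It holds for every row contraction:
the Julia operator of `T` is coisometric, so for `r < 1` the defect of `Θ_r^*` is the energy of the
state `(I - rA^*)^{-1} (I ⊗ Δ_T) x`, where `A = ∑ R_i ⊗ T_i^*`. Its component at the empty word
tends to `K^* x`, and the rest carries the factor `1 - r²`. The operators `Θ_r^*` converge a priori only
weakly; on the range of the dilation `e_α ⊗ k ↦ t^|α| e_α ⊗ k` with `t < 1`, which is dense,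
everything converges in norm, because there the parameter `r` is replaced by `tr`.

The constrained characteristic function is the compression of `Θ` to the coinvariant space
`N_J ⊗ D_{T^*}`, `N_J ⊗ D_T`, and it is always multi-analytic. Hence it is outer if and only if
`Θ^*` is injective on `N_J ⊗ D_T`, that is, if and only if no nonzero `x` in `N_J ⊗ D_T` has
`‖K^* x‖ = ‖x‖` (`isOuter_constrainedCharFun_iff`). Since `T` is `J`-constrained, the range of `K`
lies in `N_J ⊗ D_T` (`poisson_mem_tensorSpace`), and as `K` is a contraction such an `x` exists if
and only if `‖K h‖ = ‖h‖` for some `h ≠ 0`. Finally `‖h‖² - ‖K h‖²` telescopes to the limit of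
`∑_{|α| = k} ‖T_α^* h‖²`, which vanishes exactly when `∑_{|α| = k} T_α T_α^* h → 0`
(`tendsto_zero_iff_norm_poisson`).
-/

namespace NCFock

/-! ### The dilation and the coordinates of Fock space -/

section Dilation

variable {n : ℕ} {K K' : Type*}
  [NormedAddCommGroup K] [InnerProductSpace ℂ K] [CompleteSpace K]
  [NormedAddCommGroup K'] [InnerProductSpace ℂ K'] [CompleteSpace K']

theorem inner_dil (t : Set.Icc (0 : ℝ) 1) (x y : Fock n K) :
    ⟪dil K t x, y⟫_ℂ = ⟪x, dil K t y⟫_ℂ := by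
  rw [lp.inner_eq_tsum, lp.inner_eq_tsum]
  congr 1
  funext a
  simp [dil_apply, inner_smul_left, inner_smul_right]

theorem norm_dil_le (t : Set.Icc (0 : ℝ) 1) (x : Fock n K) : ‖dil K t x‖ ≤ ‖x‖ := by
  refine (sq_le_sq₀ (norm_nonneg _) (norm_nonneg _)).1 ?_
  rw [norm_sq_eq, norm_sq_eq]
  refine Summable.tsum_le_tsum (fun a => ?_) (summable_sq _) (summable_sq x)
  refine pow_le_pow_left₀ (norm_nonneg _) ?_ 2
  rw [dil_apply, norm_smul, norm_pow, Complex.norm_real, Real.norm_of_nonneg t.2.1]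
  exact mul_le_of_le_one_left (norm_nonneg _) (pow_le_one₀ t.2.1 t.2.2)

theorem continuous_dil (t : Set.Icc (0 : ℝ) 1) : Continuous (dil K t : Fock n K → Fock n K) :=
  (LinearMap.mkContinuous (dil K t) 1 fun x => by simpa using norm_dil_le t x).continuous

theorem dil_single_one (t : Set.Icc (0 : ℝ) 1) (k : K) :
    dil K t (lp.single 2 (1 : Word n) k) = lp.single 2 1 k := by
  ext a
  by_cases h : a = 1
  · subst h
    simp [dil_apply]
  · simp [dil_apply, Pi.single_eq_of_ne h]

/-- For `t ≠ 0` the dilation only rescales the vectors `e_α ⊗ k`, so its range is dense. -/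
theorem denseRange_dil {t : Set.Icc (0 : ℝ) 1} (ht : (t : ℝ) ≠ 0) :
    DenseRange (dil K t : Fock n K → Fock n K) := by
  intro x
  have h := lp.hasSum_single (p := 2) (by norm_num) x
  refine mem_closure_of_tendsto h (Eventually.of_forall fun s => ?_)
  refine ⟨∑ a ∈ s, lp.single 2 a (((t : ℂ) ^ a.length)⁻¹ • x a), ?_⟩
  rw [map_sum]
  refine Finset.sum_congr rfl fun a _ => ?_
  have hne : ((t : ℝ) : ℂ) ^ a.length ≠ 0 := pow_ne_zero _ (by exact_mod_cast ht)
  ext b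
  by_cases hb : b = a
  · subst hb
    simp [dil_apply, smul_smul, hne]
  · simp [dil_apply, Pi.single_eq_of_ne hb]

theorem adjoint_ampl (X : K →L[ℂ] K') :
    ((ampl X : Fock n K →L[ℂ] Fock n K')†) = ampl (X†) := by
  refine ((ContinuousLinearMap.eq_adjoint_iff _ _).2 fun x y => ?_).symm
  rw [lp.inner_eq_tsum, lp.inner_eq_tsum]
  congr 1
  funext a
  simp [ContinuousLinearMap.adjoint_inner_left]

end Dilation

/-! ### Adjoint of the transfer function -/

section Transfer

variable {n : ℕ} {H E D D' : Type*}
  [NormedAddCommGroup H] [InnerProductSpace ℂ H] [CompleteSpace H]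
  [NormedAddCommGroup E] [InnerProductSpace ℂ E] [CompleteSpace E]
  [NormedAddCommGroup D] [InnerProductSpace ℂ D] [CompleteSpace D]
  [NormedAddCommGroup D'] [InnerProductSpace ℂ D'] [CompleteSpace D']
  {A : Fock n H →L[ℂ] Fock n H} {G : Fock n E →L[ℂ] Fock n H}
  {X : D' →L[ℂ] D} {Y : H →L[ℂ] D} {Z : D' →L[ℂ] E} {B : H →L[ℂ] E}

theorem adjoint_apply_adjoint_of_mul_eq_one {M N : H →L[ℂ] H} (h : N * M = 1) (x : H) :
    (M†) ((N†) x) = x := by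
  have e := congrArg star h
  rw [star_mul, star_one] at e
  exact congrArg (fun L : H →L[ℂ] H => L x) e

theorem radial_adjoint_apply (r : ℝ) (x : Fock n D) :
    ((radial A G X Y Z r)†) x = -ampl (X†) x +
      ampl (Z†) ((r : ℂ) • (G†) (((Ring.inverse (1 - (r : ℂ) • A))†) (ampl (Y†) x))) := by
  simp only [radial, map_add, map_neg, ContinuousLinearMap.adjoint_comp, adjoint_ampl,
    map_smulₛₗ, add_apply, neg_apply, ContinuousLinearMap.comp_apply, smul_apply,
    Complex.conj_ofReal]

/-- Energy balance for the adjoint of the transfer function of a coisometric colligation: with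
`g = (I - rA^*)^{-1} (I ⊗ Y^*) x`, the norm lost is `‖g‖² - r² ‖G^* g‖²`. -/
theorem radial_adjoint_norm_sq (hA : ‖A‖ ≤ 1) (hAG : ∀ x, A x = G (ampl B x))
    (hG : ∀ g, ‖g‖ ^ 2 = ‖(G†) g‖ ^ 2 + ‖g 1‖ ^ 2)
    (hJ : ∀ a y, ‖(B†) a + (Y†) y‖ ^ 2 + ‖-(X†) y + (Z†) a‖ ^ 2 = ‖a‖ ^ 2 + ‖y‖ ^ 2)
    {r : ℝ} (h0 : 0 ≤ r) (h1 : r < 1) (x : Fock n D) :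
    ‖((radial A G X Y Z r)†) x‖ ^ 2 +
      ‖(((Ring.inverse (1 - (r : ℂ) • A))†) (ampl (Y†) x) : Fock n H) 1‖ ^ 2 +
      (1 - r ^ 2) * ‖(G†) (((Ring.inverse (1 - (r : ℂ) • A))†) (ampl (Y†) x))‖ ^ 2 = ‖x‖ ^ 2 := by
  rw [radial_adjoint_apply]
  have hu := isUnit_one_sub hA h0 h1
  have hinv : ((1 - (r : ℂ) • A)†) (((Ring.inverse (1 - (r : ℂ) • A))†) (ampl (Y†) x)) =
      ampl (Y†) x :=
    adjoint_apply_adjoint_of_mul_eq_one (Ring.inverse_mul_cancel _ hu) _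
  generalize ((Ring.inverse (1 - (r : ℂ) • A))†) (ampl (Y†) x) = g at hinv ⊢
  have hAe : A = G ∘L ampl B := ContinuousLinearMap.ext hAG
  have e1 : g = ampl (B†) ((r : ℂ) • (G†) g) + ampl (Y†) x := by
    have e2 : (A†) g = ampl (B†) ((G†) g) := by
      rw [hAe, ContinuousLinearMap.adjoint_comp, adjoint_ampl]
      rfl
    have e3 : ((1 - (r : ℂ) • A)†) g = g - (r : ℂ) • (A†) g := by
      rw [map_sub, map_smulₛₗ, Complex.conj_ofReal, ← ContinuousLinearMap.star_eq_adjoint 1,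
        star_one]
      rfl
    rw [← hinv, e3, e2, map_smul]
    abel
  have e3 : ‖ampl (B†) ((r : ℂ) • (G†) g) + ampl (Y†) x‖ ^ 2 +
      ‖-ampl (X†) x + ampl (Z†) ((r : ℂ) • (G†) g)‖ ^ 2 =
        ‖(r : ℂ) • (G†) g‖ ^ 2 + ‖x‖ ^ 2 := by
    rw [norm_sq_eq, norm_sq_eq, norm_sq_eq, norm_sq_eq,
      ← Summable.tsum_add (summable_sq _) (summable_sq _),
      ← Summable.tsum_add (summable_sq _) (summable_sq _)]
    congr 1
    funext a
    exact hJ (((r : ℂ) • (G†) g) a) (x a)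
  rw [← e1, norm_smul ((r : ℂ)), Complex.norm_real, Real.norm_of_nonneg h0, mul_pow, hG g] at e3
  linarith

theorem dil_inverse (hA : ‖A‖ ≤ 1) (hdA : ∀ t x, dil H t (A x) = (t : ℂ) • A (dil H t x))
    (t : Set.Icc (0 : ℝ) 1) {s : ℝ} (h0 : 0 ≤ s) (h1 : s < 1) (y : Fock n H) :
    dil H t (Ring.inverse (1 - (s : ℂ) • A) y) =
      Ring.inverse (1 - ((t * s : ℝ) : ℂ) • A) (dil H t y) := by
  have hu' := isUnit_one_sub hA (mul_nonneg t.2.1 h0)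
    ((mul_le_of_le_one_left h0 t.2.2).trans_lt h1)
  have hy := inverse_apply_right (isUnit_one_sub hA h0 h1) y
  generalize Ring.inverse (1 - (s : ℂ) • A) y = z at hy ⊢
  have : dil H t y = (1 - ((t * s : ℝ) : ℂ) • A) (dil H t z) := by
    rw [← hy]
    simp only [sub_apply, one_apply_eq_self, smul_apply, map_sub, map_smul, hdA,
      smul_smul, Complex.ofReal_mul, mul_comm]
  rw [this, inverse_apply_left hu']

/-- An intertwining relation with the dilation passes to the adjoints. -/
theorem adjoint_dil {K K' : Type*}
    [NormedAddCommGroup K] [InnerProductSpace ℂ K] [CompleteSpace K]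
    [NormedAddCommGroup K'] [InnerProductSpace ℂ K'] [CompleteSpace K']
    {M N : Fock n K →L[ℂ] Fock n K'} {t : Set.Icc (0 : ℝ) 1}
    (h : ∀ x, dil K' t (M x) = N (dil K t x)) (y : Fock n K') :
    (M†) (dil K' t y) = dil K t ((N†) y) := by
  refine ext_inner_right ℂ fun z => ?_
  rw [ContinuousLinearMap.adjoint_inner_left, inner_dil, h, inner_dil,
    ContinuousLinearMap.adjoint_inner_left]

theorem continuousAt_inverse (hA : ‖A‖ ≤ 1) {r : ℝ} (h0 : 0 ≤ r) (h1 : r < 1) :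
    ContinuousAt (fun s : ℝ => Ring.inverse (1 - (s : ℂ) • A)) r := by
  obtain ⟨u, hu⟩ := isUnit_one_sub hA h0 h1
  have := NormedRing.inverse_continuousAt u
  rw [hu] at this
  exact ContinuousAt.comp (f := fun s : ℝ => 1 - (s : ℂ) • A) this
    (continuous_const.sub (Complex.continuous_ofReal.smul continuous_const)).continuousAt

theorem continuousAt_inverse_adjoint_apply (hA : ‖A‖ ≤ 1) {r : ℝ} (h0 : 0 ≤ r) (h1 : r < 1)
    (y : Fock n H) :
    ContinuousAt (fun s : ℝ => ((Ring.inverse (1 - (s : ℂ) • A))†) y) r :=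
  ((ContinuousLinearMap.adjoint.continuous.continuousAt.comp
    (continuousAt_inverse hA h0 h1))).clm_apply continuousAt_const

theorem continuousAt_radial_adjoint_apply (hA : ‖A‖ ≤ 1) {r : ℝ} (h0 : 0 ≤ r) (h1 : r < 1)
    (y : Fock n D) :
    ContinuousAt (fun s : ℝ => ((radial A G X Y Z s)†) y) r := by
  simp only [radial_adjoint_apply]
  refine continuousAt_const.add ((ampl (Z†)).continuous.continuousAt.comp ?_)
  exact (Complex.continuous_ofReal.continuousAt).smul
    ((G†).continuous.continuousAt.comp (continuousAt_inverse_adjoint_apply hA h0 h1 _))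

/-- The defect of `Θ^*` for the radial limit `Θ` of the transfer function of a coisometric
colligation is `K K^*`, with `K` the observability operator of the colligation: the hypothesis `hK`
says that `K h = ∑ (I ⊗ Y) A^k (e_1 ⊗ h)`, after a dilation that makes the series converge. -/
theorem norm_adjoint_radial_limit (hA : ‖A‖ ≤ 1) (hAG : ∀ x, A x = G (ampl B x))
    (hG : ∀ g, ‖g‖ ^ 2 = ‖(G†) g‖ ^ 2 + ‖g 1‖ ^ 2)
    (hJ : ∀ a y, ‖(B†) a + (Y†) y‖ ^ 2 + ‖-(X†) y + (Z†) a‖ ^ 2 = ‖a‖ ^ 2 + ‖y‖ ^ 2)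
    (hdA : ∀ t x, dil H t (A x) = (t : ℂ) • A (dil H t x))
    (hdG : ∀ t x, dil H t (G x) = (t : ℂ) • G (dil E t x))
    {Θ : Fock n D' →L[ℂ] Fock n D}
    (hΘ : ∀ x, Tendsto (fun r => radial A G X Y Z r x) (𝓝[<] 1) (𝓝 (Θ x)))
    {t : Set.Icc (0 : ℝ) 1} (ht0 : (t : ℝ) ≠ 0) (ht1 : (t : ℝ) < 1) {K : H →L[ℂ] Fock n D}
    (hK : ∀ h, ampl Y (Ring.inverse (1 - ((t : ℝ) : ℂ) • A) (lp.single 2 1 h)) = dil D t (K h))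
    (x : Fock n D) : ‖(Θ†) x‖ ^ 2 + ‖(K†) x‖ ^ 2 = ‖x‖ ^ 2 := by
  have hmul : Tendsto (fun s : ℝ => (t : ℝ) * s) (𝓝[<] 1) (𝓝 t) := by
    have hid : Tendsto (fun r : ℝ => r) (𝓝[<] 1) (𝓝 1) :=
      tendsto_id.mono_left nhdsWithin_le_nhds
    simpa using hid.const_mul (t : ℝ)
  have hΘt : ∀ y, dil D t (Θ y) = radial A G X Y Z t (dil D' t y) := by
    intro y
    refine tendsto_nhds_unique (((continuous_dil t).tendsto _).comp (hΘ y)) ?_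
    refine ((continuousAt_radial hA t.2.1 ht1 (dil D' t y)).tendsto.comp hmul).congr' ?_
    filter_upwards [eventually_left] with s hs
    exact (dil_radial hA hdA hdG t hs.1 hs.2 y).symm
  -- The range of the dilation is dense.
  suffices key : ∀ y, ‖(Θ†) (dil D t y)‖ ^ 2 + ‖(K†) (dil D t y)‖ ^ 2 = ‖dil D t y‖ ^ 2 by
    have hc : IsClosed {x : Fock n D | ‖(Θ†) x‖ ^ 2 + ‖(K†) x‖ ^ 2 = ‖x‖ ^ 2} :=
      isClosed_eq (by fun_prop) (by fun_prop)
    exact (denseRange_dil ht0).induction_on (p := fun x => ‖(Θ†) x‖ ^ 2 + ‖(K†) x‖ ^ 2 = ‖x‖ ^ 2)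
      x hc key
  intro y
  -- The state of the adjoint system at `dil y`, and its limit.
  let g : ℝ → Fock n H := fun s => dil H t (((Ring.inverse (1 - (s : ℂ) • A))†) (ampl (Y†) y))
  have hg : Tendsto (fun s : ℝ => g (t * s)) (𝓝[<] 1) (𝓝 (g t)) :=
    (((continuous_dil t).continuousAt.comp
      (continuousAt_inverse_adjoint_apply hA t.2.1 ht1 (ampl (Y†) y))).tendsto).comp hmul
  have hev : ∀ a : Word n, Continuous fun y : Fock n H => y a := fun a =>
    (lp.evalCLM (𝕜 := ℂ) (fun _ : Word n => H) 2 a).continuous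
  have h1 : Tendsto (fun s : ℝ => ‖dil D' t (((radial A G X Y Z (t * s))†) y)‖ ^ 2 +
      ‖g (t * s) 1‖ ^ 2 + (1 - s ^ 2) * ‖(G†) (g (t * s))‖ ^ 2) (𝓝[<] 1)
      (𝓝 (‖dil D' t (((radial A G X Y Z t)†) y)‖ ^ 2 + ‖g t 1‖ ^ 2 +
        (1 - 1 ^ 2) * ‖(G†) (g t)‖ ^ 2)) := by
    have hid : Tendsto (fun r : ℝ => r) (𝓝[<] 1) (𝓝 1) :=
      tendsto_id.mono_left nhdsWithin_le_nhds
    refine (((((continuous_dil t).continuousAt.comp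
      (continuousAt_radial_adjoint_apply hA t.2.1 ht1 y)).tendsto.comp hmul).norm.pow 2).add
      ((((hev 1).tendsto _).comp hg).norm.pow 2)).add ?_
    exact ((hid.pow 2).const_sub 1).mul ((((G†).continuous.tendsto _).comp hg).norm.pow 2)
  have h2 : ‖dil D' t (((radial A G X Y Z t)†) y)‖ ^ 2 + ‖g t 1‖ ^ 2 +
        (1 - 1 ^ 2) * ‖(G†) (g t)‖ ^ 2 = ‖dil D t y‖ ^ 2 := by
    refine tendsto_nhds_unique h1 (tendsto_const_nhds.congr' ?_)
    filter_upwards [eventually_left] with s hs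
    have e1 := radial_adjoint_norm_sq (X := X) (Z := Z) hA hAG hG hJ hs.1 hs.2 (dil D t y)
    rw [adjoint_dil (fun z => dil_radial hA hdA hdG t hs.1 hs.2 z), ← dil_ampl,
      adjoint_dil (dil_inverse hA hdA t hs.1 hs.2)] at e1
    exact e1.symm
  have h3 : g t 1 = (K†) (dil D t y) := by
    refine ext_inner_right ℂ fun h => ?_
    rw [ContinuousLinearMap.adjoint_inner_left, inner_dil, ← hK,
      ← ContinuousLinearMap.adjoint_inner_left, ← ContinuousLinearMap.adjoint_inner_left,
      adjoint_ampl, ← dil_single_one t h, ← inner_dil, lp.inner_single_right]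
  rw [adjoint_dil hΘt, ← h3, ← h2]
  ring

end Transfer

/-! ### Right creation operators in coordinates -/

section Right

variable {n : ℕ} {K : Type*} [NormedAddCommGroup K] [InnerProductSpace ℂ K] [CompleteSpace K]

theorem word_eq_one_or_mul_of (a : Word n) : a = 1 ∨ ∃ b i, a = b * FreeMonoid.of i := by
  rcases List.eq_nil_or_concat' (FreeMonoid.toList a) with h | ⟨l, i, h⟩
  · exact Or.inl h
  · exact Or.inr ⟨FreeMonoid.ofList l, i, h⟩

theorem mul_of_ne_one (b : Word n) (i : Fin n) : b * FreeMonoid.of i ≠ 1 := fun h => by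
  have := congrArg FreeMonoid.length h
  simp [FreeMonoid.length_mul] at this

theorem mul_of_inj {a b : Word n} {i j : Fin n}
    (h : a * FreeMonoid.of i = b * FreeMonoid.of j) : a = b ∧ i = j := by
  have := congrArg FreeMonoid.toList h
  simpa using this

theorem rightCreation_apply_mul (i j : Fin n) (x : Fock n K) (b : Word n) :
    rightCreation K i x (b * FreeMonoid.of j) = if i = j then x b else 0 := by
  split_ifs with h
  · subst h
    exact shiftAlong_apply (mul_left_injective (FreeMonoid.of i)) x b
  · refine shiftAlong_apply' (mul_left_injective (FreeMonoid.of i)) x _ ?_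
    rintro ⟨c, hc⟩
    exact h (mul_of_inj hc).2

theorem rightCreation_apply_one (i : Fin n) (x : Fock n K) : rightCreation K i x 1 = 0 := by
  refine shiftAlong_apply' (mul_left_injective (FreeMonoid.of i)) x _ ?_
  rintro ⟨c, hc⟩
  exact mul_of_ne_one c i hc

theorem fullRow_apply_mul (z : Fock n (HPow n K)) (b : Word n) (j : Fin n) :
    fullRow n K z (b * FreeMonoid.of j) = z b j := by
  simp only [fullRow, sum_apply, ContinuousLinearMap.comp_apply, lp.coeFn_sum, Finset.sum_apply,
    rightCreation_apply_mul, Finset.sum_ite_eq', Finset.mem_univ, if_true]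
  rfl

theorem fullRow_apply_one (z : Fock n (HPow n K)) : fullRow n K z 1 = 0 := by
  simp only [fullRow, sum_apply, ContinuousLinearMap.comp_apply, lp.coeFn_sum, Finset.sum_apply,
    rightCreation_apply_one, Finset.sum_const_zero]

/-- The isometry `[R_1, …, R_n]` has range `{e_1}^⊥`. -/
theorem norm_sq_eq_fullRow_adjoint (g : Fock n K) :
    ‖g‖ ^ 2 = ‖((fullRow n K)†) g‖ ^ 2 + ‖g 1‖ ^ 2 := by
  set G := fullRow n K
  have hGG : ∀ z, (G†) (G z) = z := fun z => by
    have := (ContinuousLinearMap.norm_map_iff_adjoint_comp_self G).1 norm_fullRow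
    exact congrArg (fun L : Fock n (HPow n K) →L[ℂ] Fock n (HPow n K) => L z) this
  -- `h` is the component of `g` orthogonal to the range of `G`.
  set h := g - G ((G†) g) with hh
  have hGh : (G†) h = 0 := by rw [hh, map_sub, hGG, sub_self]
  have hh1 : h 1 = g 1 := by
    rw [hh, lp.coeFn_sub, Pi.sub_apply, fullRow_apply_one, sub_zero]
  have hsingle : h = lp.single 2 1 (g 1) := by
    ext a
    rcases word_eq_one_or_mul_of a with rfl | ⟨b, i, rfl⟩
    · rw [hh1, lp.single_apply_self]
    · rw [lp.single_apply_ne _ _ _ (mul_of_ne_one b i)]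
      refine ext_inner_left ℂ fun k => ?_
      have e : G (lp.single 2 b (PiLp.single 2 i k)) = lp.single 2 (b * FreeMonoid.of i) k := by
        ext c
        rcases word_eq_one_or_mul_of c with rfl | ⟨c, j, rfl⟩
        · rw [fullRow_apply_one, lp.single_apply_ne _ _ _ (mul_of_ne_one b i).symm]
        · rw [fullRow_apply_mul]
          by_cases hcb : c = b
          · subst hcb
            rw [lp.single_apply_self]
            by_cases hji : j = i
            · subst hji
              simp
            · rw [lp.single_apply_ne _ _ _ fun h => hji (mul_of_inj h).2]
              simp [hji]
          · rw [lp.single_apply_ne _ _ _ hcb, lp.single_apply_ne _ _ _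
              fun h => hcb (mul_of_inj h).1]
            rfl
      have := ContinuousLinearMap.adjoint_inner_right G (lp.single 2 b (PiLp.single 2 i k)) h
      rw [hGh, inner_zero_right, e, lp.inner_single_left] at this
      rw [← this, inner_zero_right]
  have hn : ‖h‖ = ‖g 1‖ := by rw [hsingle, lp.norm_single (by norm_num)]
  have horth : ⟪h, G ((G†) g)⟫_ℂ = 0 := by
    rw [← ContinuousLinearMap.adjoint_inner_left, hGh, inner_zero_left]
  have hsum : g = h + G ((G†) g) := by rw [hh, sub_add_cancel]
  conv_lhs => rw [hsum]
  rw [norm_add_sq (𝕜 := ℂ), horth, hn, norm_fullRow]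
  simp only [map_zero]
  ring

end Right

/-! ### The Julia operator of a row contraction -/

section Julia

variable {n : ℕ} {H : Type*} [NormedAddCommGroup H] [InnerProductSpace ℂ H] [CompleteSpace H]
  {T : Fin n → H →L[ℂ] H}

theorem norm_sq_defectOp (hT : IsRowContraction T) (h : H) :
    ‖defectOp T h‖ ^ 2 = ‖h‖ ^ 2 - ‖((rowOp T)†) h‖ ^ 2 := by
  have := julia hT h 0
  simp only [map_zero, add_zero, sub_zero, norm_zero] at this
  linarith

theorem norm_sq_defectOpStar (hT : IsRowContraction T) (x : HPow n H) :
    ‖defectOpStar T x‖ ^ 2 = ‖x‖ ^ 2 - ‖rowOp T x‖ ^ 2 := by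
  have := julia hT 0 x
  simp only [map_zero, zero_add, zero_sub, norm_zero, norm_neg] at this
  linarith

theorem inner_defectOp (hT : IsRowContraction T) (x y : H) :
    ⟪defectOp T x, y⟫_ℂ = ⟪x, defectOp T y⟫_ℂ := by
  rw [← ContinuousLinearMap.adjoint_inner_right,
    (defectOp_isPositive hT).isSelfAdjoint.adjoint_eq]

theorem inner_defectOpStar (hT : IsRowContraction T) (x y : HPow n H) :
    ⟪defectOpStar T x, y⟫_ℂ = ⟪x, defectOpStar T y⟫_ℂ := by
  rw [← ContinuousLinearMap.adjoint_inner_right,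
    (defectOpStar_isPositive hT).isSelfAdjoint.adjoint_eq]

theorem rowOp_adjoint_mem_defectSpaceStar (hT : IsRowContraction T) (y : defectSpace T) :
    ((rowOp T)†) (y : H) ∈ defectSpaceStar T := by
  have hy : (y : H) ∈ closure ((defectOp T).range : Set H) := y.2
  refine map_mem_closure ((rowOp T)†).continuous hy ?_
  rintro _ ⟨z, rfl⟩
  refine ⟨((rowOp T)†) z, ext_inner_right ℂ fun x => ?_⟩
  change ⟪defectOpStar T (((rowOp T)†) z), x⟫_ℂ = ⟪((rowOp T)†) (defectOp T z), x⟫_ℂ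
  rw [inner_defectOpStar hT, ContinuousLinearMap.adjoint_inner_left, rowOp_defectOpStar hT,
    ContinuousLinearMap.adjoint_inner_left, inner_defectOp hT]

theorem rowDefect_adjoint (hT : IsRowContraction T) (y : defectSpace T) :
    (((rowDefect hT)†) y : HPow n H) = ((rowOp T)†) (y : H) := by
  have : ((rowDefect hT)†) y = ⟨_, rowOp_adjoint_mem_defectSpaceStar hT y⟩ := by
    refine ext_inner_right ℂ fun z => ?_
    rw [ContinuousLinearMap.adjoint_inner_left, Submodule.coe_inner, Submodule.coe_inner,
      ContinuousLinearMap.adjoint_inner_left]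
    rfl
  rw [this]

theorem defectCod_adjoint (hT : IsRowContraction T) (y : defectSpace T) :
    ((defectCod T)†) y = defectOp T y := by
  refine ext_inner_right ℂ fun z => ?_
  rw [ContinuousLinearMap.adjoint_inner_left, Submodule.coe_inner, inner_defectOp hT]
  rfl

theorem defectStarDom_adjoint (hT : IsRowContraction T) (x : HPow n H) :
    (((defectStarDom T)†) x : HPow n H) = defectOpStar T x := by
  have : ((defectStarDom T)†) x =
      ⟨defectOpStar T x, Submodule.le_topologicalClosure _ ⟨x, rfl⟩⟩ := by
    refine ext_inner_right ℂ fun z => ?_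
    rw [ContinuousLinearMap.adjoint_inner_left, Submodule.coe_inner, inner_defectOpStar hT]
    rfl
  rw [this]

/-- The Julia operator of a row contraction is coisometric. -/
theorem julia_adjoint (hT : IsRowContraction T) (a : HPow n H) (y : defectSpace T) :
    ‖(((rowOp T)†)†) a + ((defectCod T)†) y‖ ^ 2 +
      ‖-((rowDefect hT)†) y + ((defectStarDom T)†) a‖ ^ 2 = ‖a‖ ^ 2 + ‖y‖ ^ 2 := by
  rw [Submodule.coe_norm (-((rowDefect hT)†) y + ((defectStarDom T)†) a), Submodule.coe_add,
    Submodule.coe_neg, rowDefect_adjoint, defectCod_adjoint hT, defectStarDom_adjoint hT,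
    ContinuousLinearMap.adjoint_adjoint, neg_add_eq_sub, Submodule.coe_norm y,
    norm_add_sq (𝕜 := ℂ), norm_sub_sq (𝕜 := ℂ), norm_sq_defectOp hT, norm_sq_defectOpStar hT,
    ContinuousLinearMap.adjoint_inner_right, rowOp_defectOpStar hT, inner_defectOp hT]
  ring

end Julia

/-! ### Words and the iterates of `X ↦ ∑ T_i X T_i^*` -/

section Levels

variable {n : ℕ} {H : Type*} [NormedAddCommGroup H] [InnerProductSpace ℂ H] [CompleteSpace H]
  (T : Fin n → H →L[ℂ] H)

theorem wordOp_one : wordOp T 1 = 1 := map_one _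

theorem wordOp_mul_of (a : Word n) (i : Fin n) :
    wordOp T (a * FreeMonoid.of i) = wordOp T a ∘L T i := by
  rw [wordOp, map_mul, FreeMonoid.lift_eval_of]
  rfl

theorem wordOp_mul_of_adjoint (a : Word n) (i : Fin n) (h : H) :
    ((wordOp T (a * FreeMonoid.of i))†) h = ((T i)†) (((wordOp T a)†) h) := by
  rw [wordOp_mul_of, ContinuousLinearMap.adjoint_comp]
  rfl

theorem wordOf_snoc {k : ℕ} (w : Fin k → Fin n) (i : Fin n) :
    wordOf (Fin.snoc w i : Fin (k + 1) → Fin n) = wordOf w * FreeMonoid.of i := by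
  change List.ofFn (Fin.snoc w i : Fin (k + 1) → Fin n) = List.ofFn w ++ [i]
  rw [List.ofFn_succ', List.concat_eq_append]
  simp

theorem sum_wordOf_zero {M : Type*} [AddCommMonoid M] (f : Word n → M) :
    ∑ w : Fin 0 → Fin n, f (wordOf w) = f 1 := by
  rw [Fintype.sum_unique]
  rfl

theorem sum_wordOf_succ {M : Type*} [AddCommMonoid M] (f : Word n → M) (k : ℕ) :
    ∑ w : Fin (k + 1) → Fin n, f (wordOf w) =
      ∑ w : Fin k → Fin n, ∑ i, f (wordOf w * FreeMonoid.of i) := by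
  rw [← (Fin.snocEquiv fun _ : Fin (k + 1) => Fin n).sum_comp, Fintype.sum_prod_type_right]
  refine Finset.sum_congr rfl fun w _ => Finset.sum_congr rfl fun i _ => ?_
  rw [← wordOf_snoc]
  rfl

/-- A word is a length together with a tuple of letters of that length. -/
def wordEquiv (n : ℕ) : (Σ k, Fin k → Fin n) ≃ Word n :=
  List.equivSigmaTuple.symm.trans FreeMonoid.ofList

theorem hasSum_wordOf {M : Type*} [AddCommGroup M] [UniformSpace M] [IsUniformAddGroup M]
    [CompleteSpace M] [T2Space M]
    {f : Word n → M} {s : M} (hf : HasSum f s) :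
    HasSum (fun k : ℕ => ∑ w : Fin k → Fin n, f (wordOf w)) s :=
  ((wordEquiv n).hasSum_iff.2 hf).sigma fun k => hasSum_fintype fun w : Fin k → Fin n =>
    f (wordOf w)

theorem summable_of_summable_level {f : Word n → ℝ} (hf0 : ∀ a, 0 ≤ f a)
    (hf : Summable fun k : ℕ => ∑ w : Fin k → Fin n, f (wordOf w)) : Summable f := by
  refine (wordEquiv n).summable_iff.1 ((summable_sigma_of_nonneg fun _ => hf0 _).2
    ⟨fun k => (hasSum_fintype _).summable, ?_⟩)
  refine hf.congr fun k => ?_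
  rw [tsum_fintype]
  rfl

/-- `∑_{|α| = k} ‖T_α^* h‖²`. -/
noncomputable def levelEnergy (k : ℕ) (h : H) : ℝ :=
  ∑ w : Fin k → Fin n, ‖((wordOp T (wordOf w))†) h‖ ^ 2

theorem levelEnergy_nonneg (k : ℕ) (h : H) : 0 ≤ levelEnergy T k h :=
  Finset.sum_nonneg fun _ _ => by positivity

theorem levelEnergy_zero (h : H) : levelEnergy T 0 h = ‖h‖ ^ 2 := by
  rw [levelEnergy, sum_wordOf_zero (fun a => ‖((wordOp T a)†) h‖ ^ 2), wordOp_one,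
    ← ContinuousLinearMap.star_eq_adjoint, star_one]
  rfl

variable {T}

theorem sum_norm_sq_defectCod (hT : IsRowContraction T) (k : ℕ) (h : H) :
    ∑ w : Fin k → Fin n, ‖defectCod T (((wordOp T (wordOf w))†) h)‖ ^ 2 =
      levelEnergy T k h - levelEnergy T (k + 1) h := by
  rw [levelEnergy, levelEnergy, sum_wordOf_succ (fun a => ‖((wordOp T a)†) h‖ ^ 2),
    ← Finset.sum_sub_distrib]
  refine Finset.sum_congr rfl fun w _ => ?_
  simp only [wordOp_mul_of_adjoint]
  refine (norm_sq_defectOp hT _).trans ?_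
  rw [PiLp.norm_sq_eq_of_L2]
  simp only [proj_rowOp_adjoint]

theorem levelEnergy_antitone (hT : IsRowContraction T) (h : H) :
    Antitone fun k => levelEnergy T k h :=
  antitone_nat_of_succ_le fun k => by
    rw [← sub_nonneg, ← sum_norm_sq_defectCod hT]
    positivity

theorem levelEnergy_le (hT : IsRowContraction T) (k : ℕ) (h : H) :
    levelEnergy T k h ≤ ‖h‖ ^ 2 :=
  levelEnergy_zero T h ▸ levelEnergy_antitone hT h (Nat.zero_le k)

/-- `[T_α : |α| = k]` is a row contraction, by duality with `levelEnergy_le`. -/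
theorem norm_sq_sum_wordOp_le (hT : IsRowContraction T) (k : ℕ) (x : (Fin k → Fin n) → H) :
    ‖∑ w, wordOp T (wordOf w) (x w)‖ ^ 2 ≤ ∑ w, ‖x w‖ ^ 2 := by
  set u := ∑ w, wordOp T (wordOf w) (x w) with hu
  have h1 : ‖u‖ ^ 2 ≤ ∑ w, ‖x w‖ * ‖((wordOp T (wordOf w))†) u‖ := by
    have e : ((‖u‖ ^ 2 : ℝ) : ℂ) = ∑ w, ⟪x w, ((wordOp T (wordOf w))†) u⟫_ℂ := by
      simp only [ContinuousLinearMap.adjoint_inner_right]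
      rw [← sum_inner, ← hu, inner_self_eq_norm_sq_to_K]
      norm_cast
    have e2 := congrArg norm e
    rw [Complex.norm_real, Real.norm_of_nonneg (by positivity)] at e2
    rw [e2]
    exact (norm_sum_le _ _).trans (Finset.sum_le_sum fun w _ => norm_inner_le_norm _ _)
  have h2 := Finset.sum_mul_sq_le_sq_mul_sq Finset.univ (fun w => ‖x w‖)
    (fun w => ‖((wordOp T (wordOf w))†) u‖)
  have h3 : ∑ w : Fin k → Fin n, ‖((wordOp T (wordOf w))†) u‖ ^ 2 ≤ ‖u‖ ^ 2 :=
    levelEnergy_le hT k u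
  have h5 : 0 ≤ ∑ w, ‖x w‖ ^ 2 := by positivity
  by_cases h0 : ‖u‖ ^ 2 = 0
  · rw [h0]
    exact h5
  · have hpos : 0 < ‖u‖ ^ 2 := lt_of_le_of_ne (by positivity) (Ne.symm h0)
    have h6 : (‖u‖ ^ 2) ^ 2 ≤ (∑ w, ‖x w‖ ^ 2) * ‖u‖ ^ 2 :=
      (pow_le_pow_left₀ hpos.le h1 2).trans (h2.trans (mul_le_mul_of_nonneg_left h3 h5))
    rw [sq (‖u‖ ^ 2)] at h6
    exact le_of_mul_le_mul_right h6 hpos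

theorem norm_sq_sum_wordOp_adjoint_le (hT : IsRowContraction T) (k : ℕ) (h : H) :
    ‖∑ w : Fin k → Fin n, wordOp T (wordOf w) (((wordOp T (wordOf w))†) h)‖ ^ 2 ≤
      levelEnergy T k h :=
  norm_sq_sum_wordOp_le hT k _

theorem levelEnergy_le_norm_mul (k : ℕ) (h : H) :
    levelEnergy T k h ≤
      ‖∑ w : Fin k → Fin n, wordOp T (wordOf w) (((wordOp T (wordOf w))†) h)‖ * ‖h‖ := by
  have e : ((levelEnergy T k h : ℝ) : ℂ) =
      ⟪∑ w : Fin k → Fin n, wordOp T (wordOf w) (((wordOp T (wordOf w))†) h), h⟫_ℂ := by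
    rw [sum_inner, levelEnergy, Complex.ofReal_sum]
    refine Finset.sum_congr rfl fun w _ => ?_
    rw [← ContinuousLinearMap.adjoint_inner_right, inner_self_eq_norm_sq_to_K]
    norm_cast
  have e2 := congrArg norm e
  rw [Complex.norm_real, Real.norm_of_nonneg (levelEnergy_nonneg T k h)] at e2
  rw [e2]
  exact norm_inner_le_norm _ _

theorem tendsto_levelEnergy_zero_iff (hT : IsRowContraction T) (h : H) :
    Tendsto (fun k : ℕ => ∑ w : Fin k → Fin n,
      wordOp T (wordOf w) (((wordOp T (wordOf w))†) h)) atTop (𝓝 0) ↔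
      Tendsto (fun k => levelEnergy T k h) atTop (𝓝 0) := by
  constructor
  · intro hk
    refine squeeze_zero (fun k => levelEnergy_nonneg T k h)
      (fun k => levelEnergy_le_norm_mul k h) ?_
    simpa using hk.norm.mul_const ‖h‖
  · intro hk
    refine squeeze_zero_norm (fun k => ?_) (by simpa using hk.sqrt)
    exact Real.le_sqrt_of_sq_le (norm_sq_sum_wordOp_adjoint_le hT k h)

end Levels

/-! ### The Poisson kernel -/

section Poisson

variable {n : ℕ} {H : Type*} [NormedAddCommGroup H] [InnerProductSpace ℂ H] [CompleteSpace H]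
  {T : Fin n → H →L[ℂ] H}

theorem sum_range_defectCod (hT : IsRowContraction T) (h : H) (N : ℕ) :
    ∑ k ∈ Finset.range N, ∑ w : Fin k → Fin n,
      ‖defectCod T (((wordOp T (wordOf w))†) h)‖ ^ 2 = ‖h‖ ^ 2 - levelEnergy T N h := by
  simp only [sum_norm_sq_defectCod hT]
  rw [Finset.sum_range_sub', levelEnergy_zero]

theorem summable_poisson (hT : IsRowContraction T) (h : H) :
    Summable fun a : Word n => ‖defectCod T (((wordOp T a)†) h)‖ ^ 2 := by
  refine summable_of_summable_level (fun a => by positivity)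
    (summable_of_sum_range_le (c := ‖h‖ ^ 2) (fun k => by positivity) fun N => ?_)
  rw [sum_range_defectCod hT]
  linarith [levelEnergy_nonneg T N h]

theorem tsum_poisson_le (hT : IsRowContraction T) (h : H) :
    ∑' a : Word n, ‖defectCod T (((wordOp T a)†) h)‖ ^ 2 ≤ ‖h‖ ^ 2 := by
  refine le_of_tendsto (hasSum_wordOf (summable_poisson hT h).hasSum).tendsto_sum_nat
    (Eventually.of_forall fun N => ?_)
  rw [sum_range_defectCod hT]
  linarith [levelEnergy_nonneg T N h]

/-- The Poisson kernel `h ↦ ∑ e_α ⊗ Δ_T T_α^* h` of a row contraction. -/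
noncomputable def poisson (hT : IsRowContraction T) : H →L[ℂ] Fock n (defectSpace T) :=
  LinearMap.mkContinuous
    { toFun := fun h => ⟨fun a => defectCod T (((wordOp T a)†) h),
        (memlp_iff _).2 (summable_poisson hT h)⟩
      map_add' := fun x y => by
        ext1; funext a
        exact (congrArg _ (map_add _ x y)).trans (map_add _ _ _)
      map_smul' := fun c x => by
        ext1; funext a
        exact (congrArg _ (map_smul _ c x)).trans (map_smul _ _ _) } 1 fun h => by
    refine (sq_le_sq₀ (norm_nonneg _) (by positivity)).1 ?_
    rw [norm_sq_eq, one_mul]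
    exact tsum_poisson_le hT h

theorem poisson_apply (hT : IsRowContraction T) (h : H) (a : Word n) :
    poisson hT h a = defectCod T (((wordOp T a)†) h) := rfl

theorem norm_poisson_le (hT : IsRowContraction T) : ‖poisson hT‖ ≤ 1 :=
  LinearMap.mkContinuous_norm_le _ zero_le_one _

/-- `‖h‖² - ‖K h‖² = lim ∑_{|α| = k} ‖T_α^* h‖²`, as `‖K h‖²` is a telescoping series. -/
theorem tendsto_levelEnergy (hT : IsRowContraction T) (h : H) :
    Tendsto (fun k => levelEnergy T k h) atTop (𝓝 (‖h‖ ^ 2 - ‖poisson hT h‖ ^ 2)) := by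
  have h1 := (hasSum_wordOf (summable_poisson hT h).hasSum).tendsto_sum_nat
  simp only [sum_range_defectCod hT] at h1
  have h2 := h1.const_sub (‖h‖ ^ 2)
  simp only [sub_sub_cancel] at h2
  rw [norm_sq_eq]
  exact h2

/-- The resolvent of `∑ R_i ⊗ T_i^*` at `e_1 ⊗ h` is `∑ t^|α| e_α ⊗ T_α^* h`. -/
theorem inverse_fullState_single (hT : IsRowContraction T) (t : Set.Icc (0 : ℝ) 1)
    (ht : (t : ℝ) < 1) (h : H) (a : Word n) :
    Ring.inverse (1 - ((t : ℝ) : ℂ) • fullState T) (lp.single 2 (1 : Word n) h) a =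
      ((t : ℝ) : ℂ) ^ a.length • ((wordOp T a)†) h := by
  have hu := isUnit_one_sub (E := Fock n H) (A := fullState T) (norm_fullState_le hT) t.2.1 ht
  have hv := inverse_apply_right hu (lp.single 2 (1 : Word n) h)
  generalize Ring.inverse (1 - ((t : ℝ) : ℂ) • fullState T) (lp.single 2 (1 : Word n) h) = v
    at hv ⊢
  have hv' : ∀ a, v a = (lp.single 2 (1 : Word n) h : Fock n H) a +
      ((t : ℝ) : ℂ) • fullRow n H (ampl ((rowOp T)†) v) a := by
    intro a
    rw [← hv]
    simp only [sub_apply, one_apply_eq_self, smul_apply, fullState_apply, lp.coeFn_sub,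
      lp.coeFn_smul, Pi.sub_apply, Pi.smul_apply, sub_add_cancel]
  have key : ∀ (k : ℕ) (a : Word n), a.length = k →
      v a = ((t : ℝ) : ℂ) ^ k • ((wordOp T a)†) h := by
    intro k
    induction k with
    | zero =>
      intro a ha
      obtain rfl : a = 1 := FreeMonoid.length_eq_zero.1 ha
      rw [hv', lp.single_apply_self, fullRow_apply_one, wordOp_one,
        ← ContinuousLinearMap.star_eq_adjoint, star_one]
      simp
    | succ k ih =>
      intro a ha
      rcases word_eq_one_or_mul_of a with rfl | ⟨b, i, rfl⟩
      · simp at ha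
      · rw [FreeMonoid.length_mul, FreeMonoid.length_of, Nat.add_right_cancel_iff] at ha
        rw [hv', lp.single_apply_ne _ _ _ (mul_of_ne_one b i), fullRow_apply_mul, zero_add,
          ampl_apply, proj_rowOp_adjoint, ih b ha, wordOp_mul_of_adjoint, map_smul, smul_smul,
          pow_succ']
  exact key _ a rfl

theorem ampl_defectCod_inverse_single (hT : IsRowContraction T) (t : Set.Icc (0 : ℝ) 1)
    (ht : (t : ℝ) < 1) (h : H) :
    ampl (defectCod T) (Ring.inverse (1 - ((t : ℝ) : ℂ) • fullState T)
      (lp.single 2 (1 : Word n) h)) = dil (defectSpace T) t (poisson hT h) := by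
  ext1
  funext a
  exact (congrArg (defectCod T) (inverse_fullState_single hT t ht h a)).trans (map_smul _ _ _)

end Poisson

/-! ### The range of the Poisson kernel of a constrained row contraction -/

section Constrained

variable {n : ℕ} {H : Type*} [NormedAddCommGroup H] [InnerProductSpace ℂ H] [CompleteSpace H]
  {K : Type*} [NormedAddCommGroup K] [InnerProductSpace ℂ K] [CompleteSpace K]
  {T : Fin n → H →L[ℂ] H} {J : TwoSidedIdeal (toeplitzAlgebra n)}

theorem norm_sum_fourierCoeff_smul_wordOp_le (hT : IsRowContraction T) (f : toeplitzAlgebra n)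
    (k : ℕ) :
    ‖∑ w : Fin k → Fin n, fourierCoeff f (wordOf w) • wordOp T (wordOf w)‖ ≤
      ‖f.1 (lp.single 2 (1 : Word n) (1 : ℂ))‖ := by
  refine ContinuousLinearMap.opNorm_le_bound _ (norm_nonneg _) fun x => ?_
  refine (sq_le_sq₀ (norm_nonneg _) (by positivity)).1 ?_
  have h1 := norm_sq_sum_wordOp_le hT k fun w => fourierCoeff f (wordOf w) • x
  simp only [map_smul, norm_smul, mul_pow, ← Finset.sum_mul] at h1
  simp only [sum_apply, smul_apply]
  refine h1.trans ?_
  rw [mul_pow]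
  refine mul_le_mul_of_nonneg_right ?_ (by positivity)
  rw [norm_sq_eq]
  exact le_hasSum (hasSum_wordOf (summable_sq (f.1 (lp.single 2 (1 : Word n) (1 : ℂ)))).hasSum) k
    fun _ _ => by positivity

theorem hasSum_radialCalculus (hT : IsRowContraction T) (f : toeplitzAlgebra n) {r : ℝ}
    (h0 : 0 ≤ r) (h1 : r < 1) :
    HasSum (fun k : ℕ => (r : ℂ) ^ k •
      ∑ w : Fin k → Fin n, fourierCoeff f (wordOf w) • wordOp T (wordOf w))
      (radialCalculus T f r) := by
  have e : ∀ k : ℕ, ∑ w : Fin k → Fin n,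
      ((r : ℂ) ^ k * fourierCoeff f (wordOf w)) • wordOp T (wordOf w) =
      (r : ℂ) ^ k • ∑ w : Fin k → Fin n, fourierCoeff f (wordOf w) • wordOp T (wordOf w) :=
    fun k => by simp only [Finset.smul_sum, mul_smul]
  simp only [radialCalculus, e]
  refine Summable.hasSum (Summable.of_norm_bounded
    ((summable_geometric_of_lt_one h0 h1).mul_right
      ‖f.1 (lp.single 2 (1 : Word n) (1 : ℂ))‖) fun k => ?_)
  rw [norm_smul, norm_pow, Complex.norm_real, Real.norm_of_nonneg h0]
  exact mul_le_mul_of_nonneg_left (norm_sum_fourierCoeff_smul_wordOp_le hT f k) (by positivity)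

/-- If `f(T) = 0`, Abel's theorem makes the series `∑ a_α ⟨h, T_α Δ_T y⟩` sum to zero. -/
theorem inner_poisson_tmul_eq_zero (hT : IsRowContraction T) {f : toeplitzAlgebra n}
    (hf : HasFunctionalCalculus T f 0) (h : H) (y : defectSpace T) :
    ⟪poisson hT h, tmul (f.1 (lp.single 2 (1 : Word n) (1 : ℂ))) y⟫_ℂ = 0 := by
  have h1 := (hasSum_wordOf (lp.hasSum_inner (𝕜 := ℂ) (poisson hT h)
    (tmul (f.1 (lp.single 2 (1 : Word n) (1 : ℂ))) y))).tendsto_sum_nat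
  have h2 := tendsto_map'_iff.1 (Complex.tendsto_tsum_powerSeries_nhdsWithin_lt h1)
  refine tendsto_nhds_unique h2 ?_
  have h3 := (tendsto_const_nhds (x := h)).inner (𝕜 := ℂ) (hf (defectOp T y))
  rw [zero_apply, inner_zero_right] at h3
  refine h3.congr' ?_
  filter_upwards [eventually_left] with r hr
  have h4 := (hasSum_radialCalculus hT f hr.1 hr.2).mapL
    (innerSL ℂ h ∘L ContinuousLinearMap.apply ℂ H (defectOp T y))
  refine h4.tsum_eq.symm.trans (tsum_congr fun k => ?_)
  have h5 : ∀ a : Word n, ⟪poisson hT h a,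
      tmul (f.1 (lp.single 2 (1 : Word n) (1 : ℂ))) y a⟫_ℂ =
        ⟪h, fourierCoeff f a • wordOp T a (defectOp T y)⟫_ℂ := by
    intro a
    rw [tmul_apply, inner_smul_right, inner_smul_right, poisson_apply, Submodule.coe_inner,
      ← ContinuousLinearMap.adjoint_inner_left, ← inner_defectOp hT]
    rfl
  simp only [h5, ← inner_sum]
  change ⟪h, ((r : ℂ) ^ k • ∑ w : Fin k → Fin n,
    fourierCoeff f (wordOf w) • wordOp T (wordOf w)) (defectOp T y)⟫_ℂ = _
  simp only [smul_apply, sum_apply, inner_smul_right, mul_comm]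

theorem tmul_eq_ampl (f : FockSpace n) (k : K) :
    tmul f k = ampl (ContinuousLinearMap.toSpanSingleton ℂ k) f := rfl

theorem leftCreation_single (i : Fin n) (a : Word n) (k : K) :
    leftCreation K i (lp.single 2 a k) = lp.single 2 (FreeMonoid.of i * a) k := by
  have hσ : Function.Injective fun b : Word n => FreeMonoid.of i * b := mul_right_injective _
  ext c
  by_cases h : ∃ b, FreeMonoid.of i * b = c
  · obtain ⟨b, rfl⟩ := h
    refine (shiftAlong_apply hσ _ b).trans ?_
    by_cases hb : b = a
    · subst hb
      rw [lp.single_apply_self, lp.single_apply_self]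
    · rw [lp.single_apply_ne _ _ _ hb, lp.single_apply_ne _ _ _ (hσ.ne hb)]
  · refine (shiftAlong_apply' hσ _ c h).trans ?_
    rw [lp.single_apply_ne _ _ _ fun hc => h ⟨a, hc.symm⟩]

theorem leftCreation_mem_toeplitzAlgebra (i : Fin n) :
    ContinuousLinearMapWOT.ofCLM (leftCreation ℂ i) ∈ toeplitzAlgebra n :=
  Subalgebra.le_topologicalClosure _ (Algebra.subset_adjoin ⟨i, rfl⟩)

theorem exists_toeplitzAlgebra_apply_vacuum (a : Word n) :
    ∃ s : toeplitzAlgebra n, s.1 (lp.single 2 (1 : Word n) (1 : ℂ)) = lp.single 2 a (1 : ℂ) := by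
  induction a using FreeMonoid.inductionOn' with
  | one => exact ⟨1, rfl⟩
  | of_mul i a ih =>
    obtain ⟨s, hs⟩ := ih
    refine ⟨⟨_, leftCreation_mem_toeplitzAlgebra i⟩ * s, ?_⟩
    change leftCreation ℂ i (s.1 _) = _
    rw [hs, leftCreation_single]

theorem inner_poisson_tmul_of_mem_idealSpace (hT : IsRowContraction T) (hJ : IsConstrained T J)
    (h : H) (y : defectSpace T) {g : FockSpace n} (hg : g ∈ idealSpace J) :
    ⟪poisson hT h, tmul g y⟫_ℂ = 0 := by
  let φ : FockSpace n →L[ℂ] ℂ :=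
    innerSL ℂ (poisson hT h) ∘L ampl (ContinuousLinearMap.toSpanSingleton ℂ y)
  suffices hle : idealSpace J ≤ φ.ker from hle hg
  refine Submodule.topologicalClosure_minimal _ (Submodule.span_le.2 ?_) φ.isClosed_ker
  rintro _ ⟨f, hf, x, rfl⟩
  -- `f e_α = (f S_α) e_1`, and `f S_α` is again in the ideal.
  have h1 : ∀ a : Word n, φ (f.1 (lp.single 2 a (1 : ℂ))) = 0 := by
    intro a
    obtain ⟨s, hs⟩ := exists_toeplitzAlgebra_apply_vacuum a
    rw [← hs]
    exact inner_poisson_tmul_eq_zero hT (hJ (f * s) (J.mul_mem_right f s hf)) h y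
  have h2 := (lp.hasSum_single (p := 2) (by norm_num) x).mapL (φ ∘L f.1.toCLM)
  refine h2.unique ?_
  convert hasSum_zero using 2 with a
  have : (lp.single 2 a (x a) : FockSpace n) = x a • lp.single 2 a (1 : ℂ) := by
    rw [← lp.single_smul, smul_eq_mul, mul_one]
  rw [this, map_smul]
  exact (congrArg _ (h1 a)).trans (smul_zero _)

/-- `N_J ⊗ K` is the whole orthogonal complement of `M_J ⊗ K`. -/
theorem mem_tensorSpace_of_inner_eq_zero {x : Fock n K}
    (hx : ∀ g ∈ idealSpace J, ∀ k : K, ⟪x, tmul g k⟫_ℂ = 0) : x ∈ tensorSpace J K := by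
  have key : ∀ (g : FockSpace n) (k : K),
      ⟪x, tmul g k⟫_ℂ = ⟪(tensorSpace J K).starProjection x, tmul g k⟫_ℂ := by
    intro g k
    rw [Submodule.inner_starProjection_left_eq_right, starProjection_tmul, ← sub_eq_zero,
      ← inner_sub_right]
    have hg : g - (modelSpace J).starProjection g ∈ idealSpace J := by
      have h1 := Submodule.sub_starProjection_mem_orthogonal (K := modelSpace J) g
      change _ ∈ (idealSpace J)ᗮᗮ at h1
      rw [Submodule.orthogonal_orthogonal_eq_closure] at h1
      exact Submodule.topologicalClosure_minimal _ le_rfl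
        (Submodule.isClosed_topologicalClosure _) h1
    rw [← hx _ hg k]
    congr 1
    rw [tmul_eq_ampl, tmul_eq_ampl, tmul_eq_ampl, map_sub]
  have : (tensorSpace J K).starProjection x = x := by
    ext a
    refine ext_inner_right ℂ fun k => ?_
    have h1 := key (lp.single 2 a 1) k
    have h2 : tmul (lp.single 2 a (1 : ℂ)) k = (lp.single 2 a k : Fock n K) := by
      ext b
      by_cases hb : b = a
      · subst hb
        rw [tmul_apply, lp.single_apply_self, lp.single_apply_self, one_smul]
      · rw [tmul_apply, lp.single_apply_ne _ _ _ hb, lp.single_apply_ne _ _ _ hb, zero_smul]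
    rw [h2, lp.inner_single_right, lp.inner_single_right] at h1
    exact h1.symm
  rw [← this]
  exact Submodule.starProjection_apply_mem _ _

theorem poisson_mem_tensorSpace (hT : IsRowContraction T) (hJ : IsConstrained T J) (h : H) :
    poisson hT h ∈ tensorSpace J (defectSpace T) :=
  mem_tensorSpace_of_inner_eq_zero fun _ hg k =>
    inner_poisson_tmul_of_mem_idealSpace hT hJ h k hg

end Constrained

/-! ### The constrained characteristic function as a compression -/

section CharFun

variable {n : ℕ} {H : Type*} [NormedAddCommGroup H] [InnerProductSpace ℂ H] [CompleteSpace H]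
  {K K' : Type*}
  [NormedAddCommGroup K] [InnerProductSpace ℂ K] [CompleteSpace K]
  [NormedAddCommGroup K'] [InnerProductSpace ℂ K'] [CompleteSpace K']
  {T : Fin n → H →L[ℂ] H} (J : TwoSidedIdeal (toeplitzAlgebra n))

theorem leftCreation_ampl (X : K →L[ℂ] K') (i : Fin n) (x : Fock n K) :
    leftCreation K' i (ampl X x) = ampl X (leftCreation K i x) := by
  have hσ : Function.Injective fun b : Word n => FreeMonoid.of i * b := mul_right_injective _
  ext1
  funext c
  rw [ampl_apply]
  by_cases h : ∃ b, FreeMonoid.of i * b = c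
  · obtain ⟨b, rfl⟩ := h
    exact (shiftAlong_apply hσ _ b).trans (congrArg X (shiftAlong_apply hσ x b)).symm
  · exact (shiftAlong_apply' hσ _ c h).trans
      ((congrArg X (shiftAlong_apply' hσ x c h)).trans (map_zero X)).symm

theorem leftCreation_fullRow (i : Fin n) (z : Fock n (HPow n H)) :
    leftCreation H i (fullRow n H z) = fullRow n H (leftCreation (HPow n H) i z) := by
  simp only [fullRow, sum_apply, ContinuousLinearMap.comp_apply, map_sum, ← right_left_comm,
    leftCreation_ampl]

theorem leftCreation_radial {E D D' : Type*}
    [NormedAddCommGroup E] [InnerProductSpace ℂ E] [CompleteSpace E]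
    [NormedAddCommGroup D] [InnerProductSpace ℂ D] [CompleteSpace D]
    [NormedAddCommGroup D'] [InnerProductSpace ℂ D'] [CompleteSpace D']
    {A : Fock n H →L[ℂ] Fock n H} {G : Fock n E →L[ℂ] Fock n H}
    {X : D' →L[ℂ] D} {Y : H →L[ℂ] D} {Z : D' →L[ℂ] E} (hA : ‖A‖ ≤ 1) {i : Fin n}
    (hSA : ∀ x, leftCreation H i (A x) = A (leftCreation H i x))
    (hSG : ∀ x, leftCreation H i (G x) = G (leftCreation E i x))
    {r : ℝ} (h0 : 0 ≤ r) (h1 : r < 1) (x : Fock n D') :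
    leftCreation D i (radial A G X Y Z r x) = radial A G X Y Z r (leftCreation D' i x) := by
  have hu := isUnit_one_sub hA h0 h1
  have key : ∀ y, leftCreation H i (Ring.inverse (1 - (r : ℂ) • A) y) =
      Ring.inverse (1 - (r : ℂ) • A) (leftCreation H i y) := by
    intro y
    have hy := inverse_apply_right hu y
    generalize Ring.inverse (1 - (r : ℂ) • A) y = z at hy ⊢
    have : leftCreation H i y = (1 - (r : ℂ) • A) (leftCreation H i z) := by
      rw [← hy]
      simp only [sub_apply, one_apply_eq_self, smul_apply, map_sub, map_smul, hSA]
    rw [this, inverse_apply_left hu]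
  rw [radial_apply, radial_apply, map_add, map_neg, leftCreation_ampl, leftCreation_ampl, key,
    map_smul, hSG, leftCreation_ampl]

theorem inner_leftCreation_tmul (i : Fin n) (f : FockSpace n) (k : K) (y : Fock n K) :
    ⟪tmul f k, leftCreation K i y⟫_ℂ = ⟪tmul (((leftCreation ℂ i)†) f) k, y⟫_ℂ := by
  rw [tmul_eq_ampl, tmul_eq_ampl, ← ContinuousLinearMap.adjoint_inner_right,
    ← ContinuousLinearMap.adjoint_inner_right, adjoint_ampl, ← leftCreation_ampl,
    ContinuousLinearMap.adjoint_inner_left]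

theorem leftCreation_adjoint_mem {f : FockSpace n} (hf : f ∈ modelSpace J) (i : Fin n) :
    ((leftCreation ℂ i)†) f ∈ modelSpace J := by
  rw [mem_modelSpace_iff] at hf ⊢
  intro g hg x
  rw [ContinuousLinearMap.adjoint_inner_right]
  exact hf (⟨_, leftCreation_mem_toeplitzAlgebra i⟩ * g) (J.mul_mem_left _ _ hg) x

theorem leftCreation_coinvariant (i : Fin n) {y : Fock n K} (hy : y ∈ (tensorSpace J K)ᗮ) :
    leftCreation K i y ∈ (tensorSpace J K)ᗮ := by
  rw [mem_tensorSpace_orthogonal_iff] at hy ⊢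
  intro f hf k
  rw [inner_leftCreation_tmul]
  exact hy _ (leftCreation_adjoint_mem J hf i) k

theorem constrainedLeft_projection (i : Fin n) (x : Fock n K) :
    constrainedLeft J K i ((tensorSpace J K).orthogonalProjectionOnto x) =
      (tensorSpace J K).orthogonalProjectionOnto (leftCreation K i x) :=
  compress_apply_projection J (fun _ hy => leftCreation_coinvariant J i hy) x

/-- `Θ` is the unconstrained characteristic function of `T`, as a radial limit. -/
def IsCharFun (hT : IsRowContraction T)
    (Θ : Fock n (defectSpaceStar T) →L[ℂ] Fock n (defectSpace T)) : Prop :=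
  ∀ x, Tendsto (fun r => radial (fullState T) (fullRow n H) (rowDefect hT) (defectCod T)
    (defectStarDom T) r x) (𝓝[<] 1) (𝓝 (Θ x))

theorem exists_isCharFun (hT : IsRowContraction T) : ∃ Θ, IsCharFun hT Θ :=
  exists_radial_limit (A := fullState T) (G := fullRow n H)
    (X := rowDefect hT) (Y := defectCod T) (Z := defectStarDom T) (B := (rowOp T)†)
    (norm_fullState_le hT) fullState_apply norm_fullRow
    (fun h x => by
      have := julia hT h (x : HPow n H)
      rw [sub_eq_neg_add] at this
      exact this) dil_fullState dil_fullRow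

variable {Θ : Fock n (defectSpaceStar T) →L[ℂ] Fock n (defectSpace T)}

/-- `I - Θ Θ^* = K K^*`, with `K` the Poisson kernel. -/
theorem IsCharFun.norm_adjoint {hT : IsRowContraction T} (hΘ : IsCharFun hT Θ)
    (x : Fock n (defectSpace T)) : ‖(Θ†) x‖ ^ 2 + ‖((poisson hT)†) x‖ ^ 2 = ‖x‖ ^ 2 := by
  let t : Set.Icc (0 : ℝ) 1 := ⟨1 / 2, by norm_num, by norm_num⟩
  have ht1 : (t : ℝ) < 1 := by norm_num [t]
  exact norm_adjoint_radial_limit (A := fullState T) (G := fullRow n H)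
    (X := rowDefect hT) (Y := defectCod T) (Z := defectStarDom T) (B := (rowOp T)†)
    (norm_fullState_le hT) fullState_apply norm_sq_eq_fullRow_adjoint (julia_adjoint hT)
    dil_fullState dil_fullRow hΘ (t := t) (by norm_num [t]) ht1
    (ampl_defectCod_inverse_single hT t ht1) x

theorem IsCharFun.map_leftCreation {hT : IsRowContraction T} (hΘ : IsCharFun hT Θ) (i : Fin n)
    (x : Fock n (defectSpaceStar T)) :
    Θ (leftCreation (defectSpaceStar T) i x) = leftCreation (defectSpace T) i (Θ x) := by
  refine tendsto_nhds_unique (hΘ _)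
    ((((leftCreation (defectSpace T) i).continuous.tendsto _).comp (hΘ x)).congr' ?_)
  filter_upwards [eventually_left] with r hr
  refine leftCreation_radial (A := fullState T) (G := fullRow n H) (norm_fullState_le hT) ?_
    (leftCreation_fullRow i) hr.1 hr.2 x
  intro y
  rw [fullState_apply, fullState_apply, leftCreation_fullRow, leftCreation_ampl]

theorem IsCharFun.constrainedCharFun_projection {hT : IsRowContraction T} (hΘ : IsCharFun hT Θ)
    (x : Fock n (defectSpaceStar T)) :
    constrainedCharFun J hT ((tensorSpace J (defectSpaceStar T)).orthogonalProjectionOnto x) =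
      (tensorSpace J (defectSpace T)).orthogonalProjectionOnto (Θ x) := by
  refine tendsto_nhds_unique (constrainedCharFun_spec J hT _)
    ((((tensorSpace J (defectSpace T)).orthogonalProjectionOnto.continuous.tendsto _).comp
      (hΘ x)).congr' ?_)
  filter_upwards [eventually_left] with r hr
  exact (charFunRadial_projection J hT hr.1 hr.2 x).symm

theorem isMultiAnalytic_constrainedCharFun (hT : IsRowContraction T) :
    IsMultiAnalytic J (constrainedCharFun J hT) := by
  obtain ⟨Θ, hΘ⟩ := exists_isCharFun hT
  intro i
  ext1 x
  obtain ⟨y, rfl⟩ : ∃ y, (tensorSpace J (defectSpaceStar T)).orthogonalProjectionOnto y = x :=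
    ⟨x, Submodule.orthogonalProjectionOnto_mem_subspace_eq_self x⟩
  rw [ContinuousLinearMap.comp_apply, ContinuousLinearMap.comp_apply, constrainedLeft_projection,
    hΘ.constrainedCharFun_projection, hΘ.constrainedCharFun_projection,
    constrainedLeft_projection, hΘ.map_leftCreation]

theorem IsCharFun.forall_inner_constrainedCharFun_eq_zero_iff {hT : IsRowContraction T}
    (hΘ : IsCharFun hT Θ) (x : tensorSpace J (defectSpace T)) :
    (∀ y, ⟪x, constrainedCharFun J hT y⟫_ℂ = 0) ↔ (Θ†) (x : Fock n (defectSpace T)) = 0 := by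
  have key : ∀ y : Fock n (defectSpaceStar T),
      ⟪x, constrainedCharFun J hT
        ((tensorSpace J (defectSpaceStar T)).orthogonalProjectionOnto y)⟫_ℂ =
      ⟪(Θ†) (x : Fock n (defectSpace T)), y⟫_ℂ := by
    intro y
    rw [ContinuousLinearMap.adjoint_inner_left, hΘ.constrainedCharFun_projection,
      Submodule.inner_orthogonalProjectionOnto_eq_of_mem_left]
  constructor
  · intro h
    refine ext_inner_right ℂ fun y => ?_
    rw [← key, h, inner_zero_left]
  · intro h y
    rw [← Submodule.orthogonalProjectionOnto_mem_subspace_eq_self y, key, h, inner_zero_left]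

theorem denseRange_iff_forall_inner_eq_zero {E F : Type*}
    [NormedAddCommGroup E] [InnerProductSpace ℂ E]
    [NormedAddCommGroup F] [InnerProductSpace ℂ F] [CompleteSpace F] (M : E →L[ℂ] F) :
    DenseRange M ↔ ∀ x, (∀ y, ⟪x, M y⟫_ℂ = 0) → x = 0 := by
  have h1 : DenseRange M ↔ Dense (M.range : Set F) := by
    rw [DenseRange]; rfl
  rw [h1, Submodule.dense_iff_topologicalClosure_eq_top, Submodule.topologicalClosure_eq_top_iff,
    Submodule.eq_bot_iff]
  simp only [Submodule.mem_orthogonal']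
  refine forall_congr' fun x => imp_congr_left ⟨fun h y => h _ ⟨y, rfl⟩, ?_⟩
  rintro h _ ⟨y, rfl⟩
  exact h y

/-- A contraction `V` whose adjoint preserves the norm of `x` satisfies `V V^* x = x`. -/
theorem apply_adjoint_of_norm_adjoint {E F : Type*}
    [NormedAddCommGroup E] [InnerProductSpace ℂ E] [CompleteSpace E]
    [NormedAddCommGroup F] [InnerProductSpace ℂ F] [CompleteSpace F] {V : E →L[ℂ] F}
    (hV : ‖V‖ ≤ 1) {x : F} (hx : ‖(V†) x‖ = ‖x‖) : V ((V†) x) = x := by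
  have h1 : ‖V ((V†) x)‖ ≤ ‖x‖ := by simpa [hx] using V.le_of_opNorm_le hV ((V†) x)
  have h2 : ‖V ((V†) x) - x‖ ^ 2 = ‖V ((V†) x)‖ ^ 2 - ‖x‖ ^ 2 := by
    rw [norm_sub_sq (𝕜 := ℂ), ← ContinuousLinearMap.adjoint_inner_right, inner_self_eq_norm_sq, hx]
    ring
  have h3 : ‖V ((V†) x) - x‖ ^ 2 ≤ 0 := by
    rw [h2, sub_nonpos]
    exact pow_le_pow_left₀ (norm_nonneg _) h1 2
  have h4 : ‖V ((V†) x) - x‖ = 0 := by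
    nlinarith [norm_nonneg (V ((V†) x) - x)]
  rwa [norm_eq_zero, sub_eq_zero] at h4

theorem IsCharFun.adjoint_eq_zero_iff {hT : IsRowContraction T} (hΘ : IsCharFun hT Θ)
    (x : Fock n (defectSpace T)) : (Θ†) x = 0 ↔ ‖((poisson hT)†) x‖ = ‖x‖ := by
  have h1 := hΘ.norm_adjoint x
  rw [← sq_eq_sq₀ (norm_nonneg _) (norm_nonneg _), ← h1, right_eq_add, sq_eq_zero_iff,
    norm_eq_zero]

/-- `Θ_{J,T}` is outer exactly when the adjoint of the Poisson kernel is strictly contractive at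
the nonzero vectors of `N_J ⊗ D_T`. -/
theorem isOuter_constrainedCharFun_iff (hT : IsRowContraction T) :
    IsOuter J (constrainedCharFun J hT) ↔
      ∀ x ∈ tensorSpace J (defectSpace T), ‖((poisson hT)†) x‖ = ‖x‖ → x = 0 := by
  obtain ⟨Θ, hΘ⟩ := exists_isCharFun hT
  refine (and_iff_right (isMultiAnalytic_constrainedCharFun J hT)).trans
    ((denseRange_iff_forall_inner_eq_zero (E := tensorSpace J (defectSpaceStar T))
      (F := tensorSpace J (defectSpace T)) (constrainedCharFun J hT)).trans ?_)
  constructor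
  · intro h x hx hn
    have h1 := h ⟨x, hx⟩
      ((hΘ.forall_inner_constrainedCharFun_eq_zero_iff J ⟨x, hx⟩).2
        ((hΘ.adjoint_eq_zero_iff x).2 hn))
    exact congrArg Subtype.val h1
  · intro h x hx
    exact Subtype.ext (h x x.2
      ((hΘ.adjoint_eq_zero_iff x).1 ((hΘ.forall_inner_constrainedCharFun_eq_zero_iff J x).1 hx)))

/-- The vectors `∑_{|α| = k} T_α T_α^* h` tend to `0` exactly when the Poisson kernel preserves the
norm of `h`. -/
theorem tendsto_zero_iff_norm_poisson (hT : IsRowContraction T) (h : H) :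
    Tendsto (fun k : ℕ => ∑ w : Fin k → Fin n,
      wordOp T (wordOf w) (((wordOp T (wordOf w))†) h)) atTop (𝓝 0) ↔
      ‖poisson hT h‖ = ‖h‖ := by
  have h1 := tendsto_levelEnergy hT h
  rw [tendsto_levelEnergy_zero_iff hT, ← sq_eq_sq₀ (norm_nonneg _) (norm_nonneg _),
    eq_comm (a := ‖poisson hT h‖ ^ 2), ← sub_eq_zero]
  exact ⟨fun h0 => tendsto_nhds_unique h1 h0, fun h0 => h0 ▸ h1⟩

end CharFun

end NCFock

/-- A `J`-constrained completely non-coisometric row contraction has outer constrained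
characteristic function if and only if there is no nonzero `h` with
`lim_k ∑_{|α| = k} T_α T_α^* h = 0`. -/
theorem proposition2p3 {n : ℕ} (hn : 1 ≤ n)
    {H : Type*} [NormedAddCommGroup H] [InnerProductSpace ℂ H] [CompleteSpace H]
    (J : TwoSidedIdeal (toeplitzAlgebra n)) (hJclosed : IsWOTClosed J) (hJ : J ≠ ⊤)
    (T : Fin n → H →L[ℂ] H) (hT : IsRowContraction T) (hcnc : IsCNC T)
    (hconstr : IsConstrained T J) :
    IsOuter J (constrainedCharFun J hT) ↔
      ¬ ∃ h : H, h ≠ 0 ∧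
        Tendsto
          (fun k : ℕ => ∑ w : Fin k → Fin n,
            wordOp T (wordOf w) (((wordOp T (wordOf w))†) h))
          atTop (𝓝 0) := by
  rw [isOuter_constrainedCharFun_iff]
  simp only [tendsto_zero_iff_norm_poisson hT]
  constructor
  · rintro hinj ⟨h, hne, hh⟩
    have hK' : ‖(poisson hT)†‖ ≤ 1 := by
      rw [LinearIsometryEquiv.norm_map]
      exact norm_poisson_le hT
    have h1 := apply_adjoint_of_norm_adjoint (x := h) hK'
      (by rw [ContinuousLinearMap.adjoint_adjoint]; exact hh)
    rw [ContinuousLinearMap.adjoint_adjoint] at h1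
    have h2 := hinj _ (poisson_mem_tensorSpace hT hconstr h) (by rw [h1, hh])
    exact hne (by rw [← h1, h2, map_zero])
  · intro hno x _ hx
    by_contra hne
    have h1 := apply_adjoint_of_norm_adjoint (norm_poisson_le hT) hx
    refine hno ⟨((poisson hT)†) x, fun h0 => hne ?_, by rw [h1, hx]⟩
    rw [← h1, h0, map_zero]
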